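/- **Theorem 6 (DFS).** Let $\mathbb G=(\mathbb V,\mathbb E)$ be a directed or undirected graph with $V$ vertices and $E$ edges, without self-edges and with at most one edge from any vertex to any other. The graph is given as a quantum black box, either in the *matrix model* (on input $i,j$ it tells whether there is an edge from $v_i$ to $v_j$) or in the *edge list model* (on input $i,j$ it returns the destination of the $j$-th edge out of $v_i$; the number $|d[i]|$ of these edges is known). Let $v_a$ be a vertex and $0<\epsilon\le 1$. Consider the following algorithm **DFS**. 1. Let $vis$ be a boolean array of size $V$, initially all *false*. Call DFS-BODY$(v_a)$. 2. DFS-BODY$(v_k)$: (a) visit $v_k$ and set $vis[k]=\textit{true}$; (b) use *findsol* with parameter $2V\epsilon^{-1}$ to find a neighbour $v_i$ of $v_k$ with $vis[i]=\textit{false}$, searching over the $N=|d[k]|$ edges out of $v_k$ in the edge list model and over all $N=V$ vertices in the matrix model; (c) if such a $v_i$ is found, call DFS-BODY$(v_i)$ and then go back to (b); otherwise return. Here *findsol* with parameter $e$, on a domain of size $N$, consists of up to two runs of BBHT followed by a run of BCWZ with parameter $e$, and stops as soon as a solution is found (every candidate is checked). BBHT (Boyer, Brassard, Høyer, Tapp):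 for $m=1,\lambda,\lambda^2,\dots$ with $\lambda=8/7$, as long as $m\le 2\sqrt N$, run Grover's algorithm with a uniformly random integer number $0\le j<m$ of iterations. BCWZ (Buhrman, Cleve, de Wolf, Zalka), with $T=\lceil \lg e\rceil$: for $t=1,\dots,\min(T,N)$ run the version of Grover's algorithm which is certain to succeed if there are exactly $t$ solutions; then, if $T<N$, make $T$ searches with error at most $1/2$, each consisting of three runs of Grover's algorithm with a uniformly random integer number $0\le j<\sqrt{N/T}$ of iterations. The unit of time is an elementary instruction: a query to the black box or its inverse, an access to $vis$ (possibly in superposition), visiting a vertex, a random choice, or a preparation, gate or measurement on word-sized quantum registers; arithmetic on numbers between instructions is not charged, and memory is initially blank. Then, with probability at least $1-\epsilon$, DFS executes a complete depth-first search from $v_a$: the sequence of visited vertices starts with $v_a$, has no repetitions, each further vertex is an (out-)neighbour of the most recently visited vertex that still has unvisited (out-)neighbours, and at the end no visited vertex has an unvisited (out-)neighbour. Its expected running time is $$O\!\left(\sqrt{VE\lg(V\epsilon^{-1})}\right)\ \text{in the edge list model, if } E\ge 1,\qquad O\!\left(\sqrt{V^3\lg(V\epsilon^{-1})}\right)\ \text{in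 the matrix model, if } V\ge 2,$$ with absolute implied constants. In particular, if $\epsilon^{-1}$ is polynomial in $V$, i.e. $\epsilon^{-1}\le V^d$ for a fixed $d$, the expected running time is $O(\sqrt{VE\lg V})$ in the edge list model and $O(\sqrt{V^3\lg V})$ in the matrix model, with implied constants depending only on $d$. -/

import Mathlib

open scoped ENNReal

noncomputable section

namespace QDFS

/-! ### Graphs, their two representations, depth-first search -/

/-- `E` is the number of edges of `G`: the number of ordered adjacent pairs, or, when `G` is
regarded as an undirected graph (symmetric adjacency), the number of unordered adjacent pairs. -/
def IsEdgeCount {V : ℕ} (G : Digraph (Fin V)) (E : ℕ) : Prop :=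
  E = {p : Fin V × Fin V | G.Adj p.1 p.2}.ncard ∨
    ((∀ i j, G.Adj i j → G.Adj j i) ∧ 2 * E = {p : Fin V × Fin V | G.Adj p.1 p.2}.ncard)

/-- An edge list representation of `G`: for each vertex `i` the destinations of its outgoing edges,
each listed once, in an arbitrary order. -/
structure EdgeList {V : ℕ} (G : Digraph (Fin V)) where
  dest : Fin V → List (Fin V)
  nodup : ∀ i, (dest i).Nodup
  mem_iff : ∀ i j, j ∈ dest i ↔ G.Adj i j

/-- `l` is the sequence of vertices, in order of their first visit, of a complete depth-first
search of `G` from `a`: it starts at `a`, does not repeat a vertex, each further vertex `w` is an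
out-neighbour of the most recently visited vertex `u` which still has an unvisited out-neighbour,
and the search stops only when no visited vertex has an unvisited out-neighbour. -/
def IsDFSOrder {V : ℕ} (G : Digraph (Fin V)) (a : Fin V) (l : List (Fin V)) : Prop :=
  l.head? = some a ∧ l.Nodup ∧
  (∀ (pre : List (Fin V)) (w : Fin V) (suf : List (Fin V)), l = pre ++ w :: suf → pre ≠ [] →
    ∃ (older : List (Fin V)) (u : Fin V) (newer : List (Fin V)), pre = older ++ u :: newer ∧
      G.Adj u w ∧ ∀ x ∈ newer, ∀ y, G.Adj x y → y ∈ pre) ∧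
  (∀ v ∈ l, ∀ w, G.Adj v w → w ∈ l)

/-- A black box holding a graph: `query i j` is its answer to the question `(i, j)`, and `size i` is
the number of indices `j = 0, 1, ...` that can be asked about the vertex `i`. -/
structure BlackBox (V : ℕ) (A : Type) where
  size : Fin V → ℕ
  query : Fin V → Fin V → A

open Classical in
/-- The adjacency matrix model: the answer to `(i, j)` is the bit telling whether there is an edge
from `i` to `j`. -/
def matrixBox {V : ℕ} (G : Digraph (Fin V)) : BlackBox V (ZMod 2) where
  size _ := V
  query i j := if G.Adj i j then 1 else 0

/-- The vertex which the answer `z` to a matrix query with index `j` exhibits as a neighbour. -/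
def matrixTarget {V : ℕ} (j : Fin V) (z : ZMod 2) : Option (Fin V) :=
  if z = 1 then some j else none

/-- The edge list model: the answer to `(i, j)` is the destination of the `j`-th edge out of `i`, and
the number of edges out of `i` is known. (Out of range answers are never used.) -/
def listBox {V : ℕ} [NeZero V] {G : Digraph (Fin V)} (L : EdgeList G) : BlackBox V (Fin V) where
  size i := (L.dest i).length
  query i j := (L.dest i).getD j 0

/-- The vertex which the answer `z` to an edge list query exhibits as a neighbour. -/
def listTarget {V : ℕ} (_ : Fin V) (z : Fin V) : Option (Fin V) := some z

/-! ### The machine: a word-level quantum random access machine with a graph black box -/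

/-- Computational basis of the quantum registers: a word `j` for the index of a query, a word `z` for
the answer of the black box, a flag qubit `f` and an auxiliary qubit `r`. -/
abbrev Basis (V : ℕ) (A : Type) : Type := Fin V × A × Bool × Bool

/-- The state space of the quantum registers. -/
abbrev Amp (V : ℕ) (A : Type) [Fintype A] : Type := EuclideanSpace ℂ (Basis V A)

/-- Pure states of the quantum registers. -/
abbrev Reg (V : ℕ) (A : Type) [Fintype A] : Type := {ψ : Amp V A // ‖ψ‖ = 1}

/-- The quantum gates (given by name, with classical parameters). -/
inductive Gate (V : ℕ) (A : Type) : Type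
  /-- ask the black box about vertex `k` and the index register, in superposition -/
  | query (k : Fin V)
  /-- the inverse of `query k` -/
  | unquery (k : Fin V)
  /-- flip the flag if the vertex computed by `t` from index and answer is not marked in `vis` -/
  | lookup (t : Fin V → A → Option (Fin V))
  /-- change the sign of the states in which flag and auxiliary qubit are both on -/
  | phase
  /-- reflection about the state `start N α` -/
  | reflect (N : ℕ) (α : ℝ)

/-- Programs: sequences of elementary instructions with classical control. Programs do not have the
graph at their disposal; they can only ask the black box. -/
inductive Prog (V : ℕ) (A : Type) (β : Type) : Type
  /-- stop with a result -/
  | ret (b : β)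
  /-- obtain the number of indices that can be asked about vertex `k` -/
  | size (k : Fin V) (c : ℕ → Prog V A β)
  /-- ask the black box a classical question -/
  | ask (k j : Fin V) (c : A → Prog V A β)
  /-- read an entry of the boolean array `vis` -/
  | read (i : Fin V) (c : Bool → Prog V A β)
  /-- write an entry of the boolean array `vis` -/
  | write (i : Fin V) (b : Bool) (c : Prog V A β)
  /-- visit the vertex `i` -/
  | visit (i : Fin V) (c : Prog V A β)
  /-- choose one of `n + 1` numbers uniformly at random -/
  | rand (n : ℕ) (c : Fin (n + 1) → Prog V A β)
  /-- put the quantum registers into the state `start N α` -/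
  | prep (N : ℕ) (α : ℝ) (c : Prog V A β)
  /-- apply a gate to the quantum registers -/
  | gate (g : Gate V A) (c : Prog V A β)
  /-- measure the quantum registers; the result is the content of the index register -/
  | meas (c : Fin V → Prog V A β)

namespace Prog

/-- Run a program, then another one depending on its result. -/
def bind' {V : ℕ} {A β γ : Type} : Prog V A β → (β → Prog V A γ) → Prog V A γ
  | ret b, h => h b
  | size k c, h => size k fun n => bind' (c n) h
  | ask k j c, h => ask k j fun z => bind' (c z) h
  | read i c, h => read i fun b => bind' (c b) h
  | write i b c, h => write i b (bind' c h)
  | visit i c, h => visit i (bind' c h)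
  | rand n c, h => rand n fun j => bind' (c j) h
  | prep N α c, h => prep N α (bind' c h)
  | gate g c, h => gate g (bind' c h)
  | meas c, h => meas fun j => bind' (c j) h

instance {V : ℕ} {A : Type} : Monad (Prog V A) where
  pure := ret
  bind := bind'

end Prog

section Semantics

variable {V : ℕ} {A : Type} [Fintype A]

open Classical in
/-- The uniform superposition of the index values `j < N`, with answer `0`, flag off, and the auxiliary
qubit in the state `cos α |0⟩ + sin α |1⟩`. -/
def start [Zero A] (N : ℕ) (α : ℝ) : Amp V A :=
  WithLp.toLp 2 fun b =>
    if b.1.val < N ∧ b.2.1 = 0 ∧ b.2.2.1 = false then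
      (((if b.2.2.2 then Real.sin α else Real.cos α) / Real.sqrt N : ℝ) : ℂ)
    else 0

open Classical in
/-- The basis state `|b⟩`. -/
def ket (b : Basis V A) : Reg V A :=
  ⟨EuclideanSpace.single b 1, by simp⟩

open Classical in
/-- The pure state with amplitudes `start N α`, which has norm one for `1 ≤ N ≤ V`; the other values
of `N` do not occur. -/
def startReg [NeZero V] [Zero A] (N : ℕ) (α : ℝ) : Reg V A :=
  if h : ‖(start N α : Amp V A)‖ = 1 then ⟨start N α, h⟩ else ket (0, 0, false, false)

/-- The reversible classical operation `|j, z⟩ ↦ |j, z + query k j⟩`. -/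
def queryPerm [AddCommGroup A] (B : BlackBox V A) (k : Fin V) : Equiv.Perm (Basis V A) where
  toFun b := (b.1, b.2.1 + B.query k b.1, b.2.2)
  invFun b := (b.1, b.2.1 - B.query k b.1, b.2.2)
  left_inv b := by simp
  right_inv b := by simp

/-- Whether index `j` and answer `z` exhibit a vertex not marked in `vis`. -/
def unvisited (t : Fin V → A → Option (Fin V)) (vis : Fin V → Bool) (j : Fin V) (z : A) : Bool :=
  match t j z with
  | none => false
  | some v => !vis v


/-- The reversible classical operation `|j, z, f⟩ ↦ |j, z, f ⊕ unvisited j z⟩`. -/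
def lookupPerm (t : Fin V → A → Option (Fin V)) (vis : Fin V → Bool) :
    Equiv.Perm (Basis V A) where
  toFun b := (b.1, b.2.1, xor b.2.2.1 (unvisited t vis b.1 b.2.1), b.2.2.2)
  invFun b := (b.1, b.2.1, xor b.2.2.1 (unvisited t vis b.1 b.2.1), b.2.2.2)
  left_inv b := by simp
  right_inv b := by simp

/-- The unitary operator of a gate, for a given black box and content of the array `vis`. -/
def Gate.op [AddCommGroup A] (B : BlackBox V A) (vis : Fin V → Bool) :
    Gate V A → (Amp V A ≃ₗᵢ[ℂ] Amp V A)
  | .query k => LinearIsometryEquiv.piLpCongrLeft 2 ℂ ℂ (queryPerm B k)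
  | .unquery k => LinearIsometryEquiv.piLpCongrLeft 2 ℂ ℂ (queryPerm B k).symm
  | .lookup t => LinearIsometryEquiv.piLpCongrLeft 2 ℂ ℂ (lookupPerm t vis)
  | .phase => LinearIsometryEquiv.piLpCongrRight 2 fun b : Basis V A =>
      if b.2.2.1 && b.2.2.2 then LinearIsometryEquiv.neg ℂ else LinearIsometryEquiv.refl ℂ ℂ
  | .reflect N α => (Submodule.span ℂ {(start N α : Amp V A)}).reflection

/-- Born's rule for a measurement in the computational basis. -/
def born (ψ : Reg V A) : PMF (Basis V A) :=
  PMF.ofFintype (fun b => ENNReal.ofReal (‖ψ.1 b‖ ^ 2)) (by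
    rw [← ENNReal.ofReal_sum_of_nonneg (fun _ _ => by positivity), ← EuclideanSpace.norm_sq_eq,
      ψ.2]
    simp)

/-- A configuration of the machine: the array `vis`, the vertices visited so far in order, the number
of instructions executed so far, and the state of the quantum registers. -/
structure Machine (V : ℕ) (A : Type) [Fintype A] where
  vis : Fin V → Bool
  out : List (Fin V)
  time : ℕ
  reg : Reg V A

/-- One more time step. -/
def Machine.tick (s : Machine V A) : Machine V A := { s with time := s.time + 1 }

/-- The law of the result and the final configuration of a program. Every instruction takes one unit
of time; computations with numbers between instructions are not charged. -/
def run [NeZero V] [AddCommGroup A] (B : BlackBox V A) {β : Type} :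
    Prog V A β → Machine V A → PMF (β × Machine V A)
  | .ret b, s => PMF.pure (b, s)
  | .size k c, s => run B (c (B.size k)) s.tick
  | .ask k j c, s => run B (c (B.query k j)) s.tick
  | .read i c, s => run B (c (s.vis i)) s.tick
  | .write i b c, s => run B c { s.tick with vis := Function.update s.vis i b }
  | .visit i c, s => run B c { s.tick with out := s.out ++ [i] }
  | .rand n c, s => (PMF.uniformOfFintype (Fin (n + 1))).bind fun j => run B (c j) s.tick
  | .prep N α c, s => run B c { s.tick with reg := startReg N α }
  | .gate g c, s => run B c { s.tick with
      reg := ⟨g.op B s.vis s.reg.1, by rw [LinearIsometryEquiv.norm_map]; exact s.reg.2⟩ }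
  | .meas c, s => (born s.reg).bind fun b => run B (c b.1) { s.tick with reg := ket b }

end Semantics

/-! ### The algorithm -/

section Algorithm

variable {V : ℕ} {A : Type}

/-- Run the programs of a list one after the other until one of them finds something. -/
def firstSome {β : Type} : List (Prog V A (Option β)) → Prog V A (Option β)
  | [] => .ret none
  | P :: Ps => do
    match ← P with
    | some x => pure (some x)
    | none => firstSome Ps

/-- Apply gates one after the other. -/
def gates : List (Gate V A) → Prog V A Unit
  | [] => .ret ()
  | g :: gs => .gate g (gates gs)

/-- Evaluate, classically, the function `F` of a search at `j`: the value at `j` is `1` when the query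
`(k, j)` exhibits an unvisited neighbour of `k`, which is then returned. -/
def evalF (t : Fin V → A → Option (Fin V)) (k j : Fin V) : Prog V A (Option (Fin V)) :=
  .ask k j fun z =>
    match t j z with
    | none => .ret none
    | some v => .read v fun b => .ret (if b then none else some v)

/-- One Grover iteration: evaluate `F` into the flag, change the sign of the marked states, undo the
evaluation, and reflect about the initial state. -/
def groverIteration (t : Fin V → A → Option (Fin V)) (k : Fin V) (N : ℕ) (α : ℝ) :
    List (Gate V A) :=
  [.query k, .lookup t, .phase, .lookup t, .unquery k, .reflect N α]

/-- Grover's algorithm with `n` iterations on the domain of the indices `< N`, started with the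
auxiliary qubit in the state `cos α |0⟩ + sin α |1⟩`; the outcome is checked with a call to `F`.
The original algorithm of Grover is the case `α = π / 2`. -/
def grover (t : Fin V → A → Option (Fin V)) (k : Fin V) (N : ℕ) (α : ℝ) (n : ℕ) :
    Prog V A (Option (Fin V)) :=
  .prep N α do
    gates (List.replicate n (groverIteration t k N α)).flatten
    .meas fun j => evalF t k j

/-- Grover's algorithm with a number of iterations which is a uniformly random integer in `[0, m)`,
for `m > 0`. -/
def randomGrover (t : Fin V → A → Option (Fin V)) (k : Fin V) (N : ℕ) (m : ℝ) :
    Prog V A (Option (Fin V)) :=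
  .rand (⌈m⌉₊ - 1) fun j => grover t k N (Real.pi / 2) j

/-- The number of values `m = 1, 8/7, (8/7)², ...` with `m ≤ 2 √N`. -/
def bbhtRounds (N : ℕ) : ℕ := sInf {c : ℕ | 2 * Real.sqrt N < (8 / 7 : ℝ) ^ c}

/-- The search algorithm *BBHT* of Boyer, Brassard, Høyer and Tapp: for `m = 1, 8/7, (8/7)², ...` as
long as `m ≤ 2 √N`, run Grover's algorithm with a random number of iterations below `m`, until a
solution is found. -/
def bbht (t : Fin V → A → Option (Fin V)) (k : Fin V) (N : ℕ) : Prog V A (Option (Fin V)) :=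
  firstSome ((List.range (bbhtRounds N)).map fun c => randomGrover t k N ((8 / 7 : ℝ) ^ c))

/-- The search which succeeds with certainty if there are exactly `M` solutions, `1 ≤ M ≤ N`: with
`θ = arcsin √(M/N)`, the number `n` of iterations is `π / (4θ) - 1/2` rounded up, and the rotation of
the auxiliary qubit reduces the angle `θ` to `π / (4n + 2)`. -/
def exactSearch (t : Fin V → A → Option (Fin V)) (k : Fin V) (N M : ℕ) :
    Prog V A (Option (Fin V)) :=
  let θ : ℝ := Real.arcsin (Real.sqrt (M / N))
  let n : ℕ := ⌈Real.pi / (4 * θ) - 1 / 2⌉₊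
  grover t k N (Real.arcsin (Real.sin (Real.pi / (4 * n + 2)) / Real.sin θ)) n

/-- The search algorithm *BCWZ* of Buhrman, Cleve, de Wolf and Zalka with parameter `e`, the
reciprocal of the allowed probability of failure. With `T` the least integer `≥ lg e`: first run the
exact searches for `1, ..., T` solutions, then (there being more than `T` solutions, if any) `T`
searches with error at most `1/2`, each of which consists of three runs of Grover's algorithm with a
random number of iterations below `√(N/T)`. -/
def bcwz (t : Fin V → A → Option (Fin V)) (k : Fin V) (N : ℕ) (e : ℝ) :
    Prog V A (Option (Fin V)) :=
  let T : ℕ := ⌈Real.logb 2 e⌉₊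
  firstSome
    ((List.range (min T N)).map (fun i => exactSearch t k N (i + 1)) ++
      if T < N then List.replicate (3 * T) (randomGrover t k N (Real.sqrt (N / T))) else [])

/-- *findsol* with parameter `e`, looking for an unvisited neighbour of `k`: run *BBHT* up to two
times, then *BCWZ*. -/
def findsol (t : Fin V → A → Option (Fin V)) (e : ℝ) (k : Fin V) : Prog V A (Option (Fin V)) :=
  .size k fun N => firstSome [bbht t k N, bbht t k N, bcwz t k N e]

/-- The loop of `DFS-BODY(k)`, after `k` has been visited: use *findsol* to find an unvisited neighbour
`i` of `k`; if there is one, perform `DFS-BODY(i)` and go back. The first argument bounds the depth of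
the nesting; as every level of nesting visits a new vertex, the bound `V` is never attained. -/
def bodyLoop (t : Fin V → A → Option (Fin V)) (e : ℝ) : ℕ → Fin V → Prog V A Unit
  | 0, _ => .ret ()
  | n + 1, k => do
    match ← findsol t e k with
    | none => pure ()
    | some i =>
      .visit i <| .write i true do
        bodyLoop t e n i
        bodyLoop t e n k

/-- *DFS* from the vertex `a`, with *findsol* called with parameter `e`. -/
def dfs (t : Fin V → A → Option (Fin V)) (e : ℝ) (a : Fin V) : Prog V A Unit :=
  .visit a <| .write a true (bodyLoop t e V a)

/-- The joint law of the sequence of visited vertices and of the running time of *DFS*, run with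
desired probability of failure `ε`. Initially the array `vis` is blank. -/
def dfsLaw [NeZero V] [Fintype A] [AddCommGroup A] (B : BlackBox V A)
    (t : Fin V → A → Option (Fin V)) (ε : ℝ) (a : Fin V) : PMF (List (Fin V) × ℕ) :=
  (run B (dfs t (2 * V * ε⁻¹) a)
    { vis := fun _ => false, out := [], time := 0, reg := ket (0, 0, false, false) }).map
    fun x => (x.2.out, x.2.time)

end Algorithm

/-- The law of *DFS* in the adjacency matrix model. -/
def matrixDFS {V : ℕ} [NeZero V] (G : Digraph (Fin V)) (ε : ℝ) (a : Fin V) :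
    PMF (List (Fin V) × ℕ) :=
  dfsLaw (matrixBox G) matrixTarget ε a

/-- The law of *DFS* in the edge list model. -/
def listDFS {V : ℕ} [NeZero V] {G : Digraph (Fin V)} (L : EdgeList G) (ε : ℝ) (a : Fin V) :
    PMF (List (Fin V) × ℕ) :=
  dfsLaw (listBox L) listTarget ε a

/-- The probability that the outcome is not a complete depth-first search of `G` from `a`. -/
def failProb {V : ℕ} (G : Digraph (Fin V)) (a : Fin V) (P : PMF (List (Fin V) × ℕ)) : ℝ≥0∞ :=
  P.toOuterMeasure {x | ¬ IsDFSOrder G a x.1}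

/-- The expected running time. -/
def expectedTime {V : ℕ} (P : PMF (List (Fin V) × ℕ)) : ℝ≥0∞ :=
  ∑' x, P x * (x.2 : ℝ≥0∞)

end QDFS

end

noncomputable section

namespace QDFS

/-! ### Expectations of nonnegative functions -/

/-! Each call of *findsol* enters the argument only through an expected cost and a failure
probability (`IsSearch`). These are bounded for one call and then amortised over the recursion.

One call, with `M` solutions among `N` indices: Grover's iteration rotates the state in the plane of
the marked and unmarked parts of the start state, so `n` iterations give the marked part the squared
norm `sin² ((2n+1)θ)`. Averaged over `n < m` this is at least 1/4 once `m ≥ √(N/M)`. In BBHT the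
lengths grow by 8/7 while the probability of still searching shrinks by 3/4. As (8/7)(3/4) < 1, the
expected cost is O(√(N/M)); as 3/4 ≤ (7/8)², the failure probability is at most 1/M. BCWZ, of cost
O(√(NT)) with `T = ⌈lg e⌉` and failure probability at most 1/e, is therefore reached with
probability at most 1/M² after two runs of BBHT. The second run matters because Σ 1/M² converges,
whereas Σ 1/M does not (`isSearch_findsol`).

Correctness: the search can go wrong only if *findsol* overlooks an existing unvisited neighbour.
There is one search at the root, and each later vertex causes two more: the first one at itself and
the next one at its parent. Hence there are at most 2V - 1 searches, each with error at most ε/(2V)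
(`expect_incomplete_bodyLoop`).

Time: `M` strictly decreases between consecutive searches at the same vertex `k`. The last search
and all the BCWZ parts at `k` thus cost O(√(N_k T)), and by Cauchy–Schwarz O(√(VDT)) over all
vertices, where `D = ∑ N_k`. Summing √(N_k/M) over all `M` would give N_k, which is too much when
`D` exceeds `V`; but fewer than `V` searches succeed. So for a parameter `l` the terms with `M ≤ l²
N_k` are summed, giving 2 l N_k, and each remaining term, at most 1/l, is charged to the vertex just
discovered. The total O(lD + V/l) is balanced by `l = √(V/D)` (`dfsPotential`,
`expect_time_bodyLoop`). Finally `D` is V² in the matrix model and at most 2E in the edge list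
model, and `T` is O(lg(V/ε)). -/

/-- The expectation of a nonnegative function of a random outcome. -/
def expect {α : Type} (μ : PMF α) (f : α → ℝ≥0∞) : ℝ≥0∞ := ∑' x, μ x * f x

section Expect

variable {α β : Type}

theorem expect_pure (a : α) (f : α → ℝ≥0∞) : expect (PMF.pure a) f = f a := by
  classical
  rw [expect, tsum_eq_single a]
  · simp
  · intro b hb
    simp [PMF.pure_apply, hb]

theorem expect_bind (μ : PMF α) (κ : α → PMF β) (f : β → ℝ≥0∞) :
    expect (μ.bind κ) f = expect μ fun x => expect (κ x) f := by
  simp only [expect, PMF.bind_apply, ← ENNReal.tsum_mul_right, ← ENNReal.tsum_mul_left]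
  rw [ENNReal.tsum_comm]
  simp only [mul_assoc]

theorem expect_map (μ : PMF α) (g : α → β) (f : β → ℝ≥0∞) :
    expect (μ.map g) f = expect μ fun x => f (g x) := by
  rw [PMF.map, expect_bind]
  simp [expect_pure]

theorem expect_mono_support {μ : PMF α} {f g : α → ℝ≥0∞} (h : ∀ x ∈ μ.support, f x ≤ g x) :
    expect μ f ≤ expect μ g := by
  refine ENNReal.tsum_le_tsum fun x => ?_
  by_cases hx : μ x = 0
  · simp [hx]
  · exact mul_le_mul_right (h x ((PMF.mem_support_iff _ _).2 hx)) _

theorem expect_mono {μ : PMF α} {f g : α → ℝ≥0∞} (h : ∀ x, f x ≤ g x) :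
    expect μ f ≤ expect μ g :=
  expect_mono_support fun x _ => h x

theorem expect_add (μ : PMF α) (f g : α → ℝ≥0∞) :
    (expect μ fun x => f x + g x) = expect μ f + expect μ g := by
  simp only [expect, mul_add, ENNReal.tsum_add]

theorem expect_const (μ : PMF α) (c : ℝ≥0∞) : (expect μ fun _ => c) = c := by
  simp [expect, ENNReal.tsum_mul_right, PMF.tsum_coe]

theorem expect_mul_const (μ : PMF α) (f : α → ℝ≥0∞) (c : ℝ≥0∞) :
    (expect μ fun x => f x * c) = expect μ f * c := by
  simp only [expect, ← mul_assoc, ENNReal.tsum_mul_right]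

theorem expect_fintype [Fintype α] (μ : PMF α) (f : α → ℝ≥0∞) :
    expect μ f = ∑ x, μ x * f x := tsum_fintype _

end Expect

/-! ### Composition of programs -/

section Evolve

variable {V : ℕ} {A : Type} [Fintype A] [AddCommGroup A] (B : BlackBox V A)

/-- The effect of a sequence of gates on the quantum registers. -/
def evolve (vis : Fin V → Bool) : List (Gate V A) → Reg V A → Reg V A
  | [], ψ => ψ
  | g :: gs, ψ => evolve vis gs
      ⟨g.op B vis ψ.1, by rw [LinearIsometryEquiv.norm_map]; exact ψ.2⟩

theorem evolve_append (vis : Fin V → Bool) (gs hs : List (Gate V A)) (ψ : Reg V A) :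
    evolve B vis (gs ++ hs) ψ = evolve B vis hs (evolve B vis gs ψ) := by
  induction gs generalizing ψ with
  | nil => rfl
  | cons g gs ih => exact ih _

end Evolve

section Run

variable {V : ℕ} {A : Type} [Fintype A] [NeZero V] [AddCommGroup A] (B : BlackBox V A)

theorem run_bind {β γ : Type} (p : Prog V A β) (h : β → Prog V A γ) (s : Machine V A) :
    run B (p.bind' h) s = (run B p s).bind fun x => run B (h x.1) x.2 := by
  induction p generalizing s with
  | ret b => simp [Prog.bind', run]
  | size k c ih => simp only [Prog.bind', run, ih]
  | ask k j c ih => simp only [Prog.bind', run, ih]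
  | read i c ih => simp only [Prog.bind', run, ih]
  | write i b c ih => simp only [Prog.bind', run, ih]
  | visit i c ih => simp only [Prog.bind', run, ih]
  | rand n c ih => simp only [Prog.bind', run, ih, PMF.bind_bind]
  | prep N α c ih => simp only [Prog.bind', run, ih]
  | gate g c ih => simp only [Prog.bind', run, ih]
  | meas c ih => simp only [Prog.bind', run, ih, PMF.bind_bind]

theorem run_gates (gs : List (Gate V A)) (s : Machine V A) :
    run B (gates gs) s =
      PMF.pure ((), { s with time := s.time + gs.length, reg := evolve B s.vis gs s.reg }) := by
  induction gs generalizing s with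
  | nil => rfl
  | cons g gs ih =>
    simp only [gates, run, ih, Machine.tick, evolve, List.length_cons]
    simp only [add_assoc, add_comm 1]

/-- The indices of the domain of a search at `k` which exhibit an unvisited vertex. -/
def solutions (t : Fin V → A → Option (Fin V)) (vis : Fin V → Bool) (k : Fin V) :
    Finset (Fin V) :=
  Finset.univ.filter fun j => j.val < B.size k ∧ unvisited t vis j (B.query k j) = true

/-- One if nothing has been found, and zero otherwise. -/
def noneInd {β : Type} : Option β → ℝ≥0∞
  | none => 1
  | some _ => 0

/-- The program `P` searches for an unvisited neighbour of `k` without side effects, with expected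
running time at most `c`, and finds nothing with probability at most `p`. -/
structure IsSearch (t : Fin V → A → Option (Fin V)) (vis : Fin V → Bool) (k : Fin V)
    (P : Prog V A (Option (Fin V))) (c p : ℝ) : Prop where
  cost_nonneg : 0 ≤ c
  fail_nonneg : 0 ≤ p
  sound : ∀ s, s.vis = vis → ∀ x ∈ (run B P s).support, x.2.vis = vis ∧ x.2.out = s.out ∧
    ∀ v, x.1 = some v → ∃ j : Fin V, j.val < B.size k ∧ t j (B.query k j) = some v ∧ vis v = false
  time : ∀ s, s.vis = vis →
    (expect (run B P s) fun x => (x.2.time : ℝ≥0∞)) ≤ s.time + ENNReal.ofReal c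
  fail : ∀ s, s.vis = vis → (expect (run B P s) fun x => noneInd x.1) ≤ ENNReal.ofReal p

/-! ### Sequential composition of searches -/

variable {B} {t : Fin V → A → Option (Fin V)} {vis : Fin V → Bool} {k : Fin V}

theorem IsSearch.mono {P : Prog V A (Option (Fin V))} {c c' p p' : ℝ}
    (h : IsSearch B t vis k P c p) (hc : c ≤ c') (hp : p ≤ p') : IsSearch B t vis k P c' p' where
  cost_nonneg := h.cost_nonneg.trans hc
  fail_nonneg := h.fail_nonneg.trans hp
  sound := h.sound
  time s hs := (h.time s hs).trans (by gcongr)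
  fail s hs := (h.fail s hs).trans (by gcongr)

theorem isSearch_firstSome_nil : IsSearch B t vis k (firstSome []) 0 1 where
  cost_nonneg := le_rfl
  fail_nonneg := zero_le_one
  sound s hs x hx := by
    simp only [firstSome, run, PMF.support_pure, Set.mem_singleton_iff] at hx
    subst hx
    simp [hs]
  time s _ := by simp [firstSome, run, expect_pure]
  fail s _ := by simp [firstSome, run, expect_pure, noneInd]

theorem run_firstSome_cons (P : Prog V A (Option (Fin V))) (Ps : List (Prog V A (Option (Fin V))))
    (s : Machine V A) :
    run B (firstSome (P :: Ps)) s = (run B P s).bind fun x =>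
      match x.1 with
      | some v => PMF.pure (some v, x.2)
      | none => run B (firstSome Ps) x.2 := by
  have : firstSome (P :: Ps) = P.bind' fun r => match r with
    | some x => .ret (some x)
    | none => firstSome Ps := by
    rw [firstSome]
    refine congrArg P.bind' (funext fun r => ?_)
    cases r <;> rfl
  rw [this, run_bind]
  congr 1
  funext x
  rcases x with ⟨_ | v, s'⟩ <;> rfl

/-- The remaining programs run only if the first finds nothing, which weights their cost by `p`. No
independence is needed: their bounds hold from every configuration with the array `vis`, and
soundness says that the first program leaves `vis` unchanged. -/
theorem IsSearch.firstSome_cons {P : Prog V A (Option (Fin V))}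
    {Ps : List (Prog V A (Option (Fin V)))} {c c' p p' : ℝ}
    (h : IsSearch B t vis k P c p) (h' : IsSearch B t vis k (firstSome Ps) c' p') :
    IsSearch B t vis k (firstSome (P :: Ps)) (c + p * c') (p * p') where
  cost_nonneg := add_nonneg h.cost_nonneg (mul_nonneg h.fail_nonneg h'.cost_nonneg)
  fail_nonneg := mul_nonneg h.fail_nonneg h'.fail_nonneg
  sound s hs x hx := by
    rw [run_firstSome_cons, PMF.mem_support_bind_iff] at hx
    obtain ⟨⟨r, s'⟩, hy, hx⟩ := hx
    obtain ⟨h1, h2, h3⟩ := h.sound s hs _ hy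
    cases r with
    | some v =>
      simp only [PMF.support_pure, Set.mem_singleton_iff] at hx
      subst hx
      exact ⟨h1, h2, h3⟩
    | none =>
      obtain ⟨h4, h5, h6⟩ := h'.sound s' h1 x hx
      exact ⟨h4, h5.trans h2, h6⟩
  time s hs := by
    rw [run_firstSome_cons, expect_bind]
    calc _ ≤ expect (run B P s) fun x => (x.2.time : ℝ≥0∞) + noneInd x.1 * ENNReal.ofReal c' := by
          refine expect_mono_support fun x hx => ?_
          obtain ⟨h1, -, -⟩ := h.sound s hs _ hx
          obtain ⟨r, s'⟩ := x
          cases r with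
          | some v => simp [expect_pure]
          | none => simpa [noneInd] using h'.time s' h1
      _ ≤ _ := by
          rw [expect_add, expect_mul_const, ENNReal.ofReal_add h.cost_nonneg
            (mul_nonneg h.fail_nonneg h'.cost_nonneg), ENNReal.ofReal_mul h.fail_nonneg, ← add_assoc]
          gcongr
          · exact h.time s hs
          · exact h.fail s hs
  fail s hs := by
    rw [run_firstSome_cons, expect_bind]
    calc _ ≤ expect (run B P s) fun x => noneInd x.1 * ENNReal.ofReal p' := by
          refine expect_mono_support fun x hx => ?_
          obtain ⟨h1, -, -⟩ := h.sound s hs _ hx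
          obtain ⟨r, s'⟩ := x
          cases r with
          | some v => simp [expect_pure, noneInd]
          | none => simpa [noneInd] using h'.fail s' h1
      _ ≤ _ := by
          rw [expect_mul_const, ENNReal.ofReal_mul h.fail_nonneg]
          gcongr
          exact h.fail s hs

end Run

/-! ### Grover's algorithm -/

section Evolve

variable {V : ℕ} {A : Type} [Fintype A] [AddCommGroup A] (B : BlackBox V A)
  (t : Fin V → A → Option (Fin V)) (vis : Fin V → Bool) (k : Fin V)

/-- The basis states which are marked in a search at `k`. -/
def marked (b : Basis V A) : Bool := unvisited t vis b.1 (B.query k b.1) && b.2.2.2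

open Classical in
/-- The marked component of the start state. -/
def goodPart (N : ℕ) (α : ℝ) : Amp V A :=
  WithLp.toLp 2 fun b => if marked B t vis k b then (start N α : Amp V A) b else 0

open Classical in
/-- The unmarked component of the start state. -/
def badPart (N : ℕ) (α : ℝ) : Amp V A :=
  WithLp.toLp 2 fun b => if marked B t vis k b then 0 else (start N α : Amp V A) b

variable {B t vis k}

theorem start_eq_zero {N : ℕ} {α : ℝ} {b : Basis V A}
    (h : ¬(b.1.val < N ∧ b.2.1 = 0 ∧ b.2.2.1 = false)) : (start N α : Amp V A) b = 0 := by
  simp [start, h]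

theorem goodPart_add_badPart (N : ℕ) (α : ℝ) :
    goodPart B t vis k N α + badPart B t vis k N α = start N α := by
  ext b
  by_cases h : marked B t vis k b <;> simp [goodPart, badPart, h]

/-- The norm squared of the amplitude of the start state at an index inside the domain. -/
theorem sum_start (N : ℕ) (α : ℝ) (S : Fin V → Prop) [DecidablePred S] (R : Bool → Prop)
    [DecidablePred R] :
    (∑ b : Basis V A, if S b.1 ∧ R b.2.2.2 then ‖(start N α : Amp V A) b‖ ^ 2 else 0) =
      ((Finset.univ.filter fun j : Fin V => j.val < N ∧ S j).card : ℝ) / N *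
        ((if R true then Real.sin α ^ 2 else 0) + (if R false then Real.cos α ^ 2 else 0)) := by
  classical
  have key : ∀ j : Fin V, (∑ c : A × Bool × Bool, if S j ∧ R c.2.2 then
      ‖(start N α : Amp V A) (j, c)‖ ^ 2 else 0) = if j.val < N ∧ S j then
        (N : ℝ)⁻¹ * ((if R true then Real.sin α ^ 2 else 0) + (if R false then Real.cos α ^ 2 else 0))
        else 0 := by
    intro j
    rw [Fintype.sum_prod_type, Finset.sum_eq_single 0]
    · rw [Fintype.sum_prod_type]
      have hN : Real.sqrt N ^ 2 = N := Real.sq_sqrt (Nat.cast_nonneg N)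
      by_cases hj : j.val < N <;> by_cases hS : S j <;> by_cases h1 : R true <;>
        by_cases h2 : R false <;>
        simp [start, hj, hS, h1, h2, -Complex.ofReal_div, -Complex.ofReal_sin, -Complex.ofReal_cos,
          Complex.norm_real, div_pow, hN, -Real.sin_sq_add_cos_sq] <;> ring
    · intro z _ hz
      refine Finset.sum_eq_zero fun c _ => ?_
      rw [start_eq_zero (by simp [hz])]
      simp
    · simp
  rw [Fintype.sum_prod_type, Finset.sum_congr rfl fun j _ => key j, ← Finset.sum_filter,
    Finset.sum_const, nsmul_eq_mul]
  ring

theorem card_lt {N : ℕ} (hN : N ≤ V) :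
    (Finset.univ.filter fun j : Fin V => j.val < N).card = N := by
  rw [Fin.card_filter_val_lt, min_eq_right hN]

theorem norm_start {N : ℕ} (h1 : 1 ≤ N) (hN : N ≤ V) (α : ℝ) : ‖(start N α : Amp V A)‖ = 1 := by
  have h := sum_start (A := A) (V := V) N α (fun _ => True) (fun _ => True)
  simp only [and_true, if_true, card_lt hN, Real.sin_sq_add_cos_sq, mul_one] at h
  rw [div_self (by positivity)] at h
  rw [EuclideanSpace.norm_eq, h, Real.sqrt_one]

theorem norm_goodPart_sq {α : ℝ} :
    ‖(goodPart B t vis k (B.size k) α : Amp V A)‖ ^ 2 =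
      (solutions B t vis k).card / B.size k * Real.sin α ^ 2 := by
  have h := sum_start (A := A) (V := V) (B.size k) α
    (fun j => unvisited t vis j (B.query k j) = true) (fun r => r = true)
  simp only [if_true, Bool.false_eq_true, if_false, add_zero] at h
  rw [solutions, ← h, EuclideanSpace.norm_sq_eq]
  refine Finset.sum_congr rfl fun b _ => ?_
  simp only [goodPart, marked, Bool.and_eq_true]
  split_ifs <;> simp

theorem inner_start_goodPart (N : ℕ) (α : ℝ) :
    inner ℂ (start N α : Amp V A) (goodPart B t vis k N α) =
      ((‖goodPart B t vis k N α‖ ^ 2 : ℝ) : ℂ) := by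
  have h : ((‖goodPart B t vis k N α‖ ^ 2 : ℝ) : ℂ) =
      inner ℂ (goodPart B t vis k N α) (goodPart B t vis k N α) := by
    rw [inner_self_eq_norm_sq_to_K]
    simp
  rw [h]
  simp only [PiLp.inner_apply]
  refine Finset.sum_congr rfl fun b _ => ?_
  by_cases h : marked B t vis k b <;> simp [goodPart, h]

/-- Computing the flag and uncomputing it cancel as permutations, so only a diagonal sign remains.
-/
theorem op_query_evaluation (ψ : Amp V A) (b : Basis V A) :
    ((Gate.unquery k).op B vis ((Gate.lookup t).op B vis (Gate.phase.op B vis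
      ((Gate.lookup t).op B vis ((Gate.query k).op B vis ψ))))) b =
    if (xor b.2.2.1 (unvisited t vis b.1 (b.2.1 + B.query k b.1)) && b.2.2.2) then - ψ b else ψ b := by
  obtain ⟨j, z, f, r⟩ := b
  simp only [Gate.op, LinearIsometryEquiv.piLpCongrLeft_apply, Equiv.piCongrLeft'_apply,
    Equiv.symm_symm, LinearIsometryEquiv.piLpCongrRight_apply]
  simp only [lookupPerm, queryPerm, Equiv.coe_fn_mk, Equiv.coe_fn_symm_mk]
  by_cases h : ((f ^^ unvisited t vis j (z + B.query k j)) && r) = true <;> simp [h]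

theorem op_reflect {N : ℕ} {α : ℝ} (h : ‖(start N α : Amp V A)‖ = 1) (ψ : Amp V A) :
    (Gate.reflect N α).op B vis ψ =
      (2 * inner ℂ (start N α : Amp V A) ψ) • (start N α : Amp V A) - ψ := by
  simp only [Gate.op]
  rw [Submodule.reflection_singleton_apply, h]
  simp [mul_smul, two_smul]

end Evolve

section Iteration

variable {V : ℕ} {A : Type} [Fintype A] [AddCommGroup A] {B : BlackBox V A}
  {t : Fin V → A → Option (Fin V)} {vis : Fin V → Bool} {k : Fin V}

/-- The start state lives on answer `0` and flag off, where the sign condition reduces to `marked`.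
-/
theorem op_query_evaluation_parts (N : ℕ) (α : ℝ) (x y : ℂ) :
    (Gate.unquery k).op B vis ((Gate.lookup t).op B vis (Gate.phase.op B vis
      ((Gate.lookup t).op B vis ((Gate.query k).op B vis
        (x • goodPart B t vis k N α + y • badPart B t vis k N α))))) =
    (-x) • goodPart B t vis k N α + y • badPart B t vis k N α := by
  ext b
  rw [op_query_evaluation]
  by_cases hb : b.1.val < N ∧ b.2.1 = 0 ∧ b.2.2.1 = false
  · obtain ⟨-, h2, h3⟩ := hb
    rw [h2, h3, zero_add, Bool.false_xor]
    by_cases h : marked B t vis k b = true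
    · have h' : (unvisited t vis b.1 (B.query k b.1) && b.2.2.2) = true := h
      rw [if_pos h']
      simp [goodPart, badPart, h]
    · have h' : ¬(unvisited t vis b.1 (B.query k b.1) && b.2.2.2) = true := h
      rw [if_neg h']
      simp [goodPart, badPart, h]
  · simp [goodPart, badPart, start_eq_zero hb]

/-- The inner products of the start state with its two parts are `σ` and `1 - σ`, so the sign change
followed by the reflection acts on the coefficients by an explicit 2 × 2 matrix. -/
theorem evolve_groverIteration {N : ℕ} {α : ℝ} (hs : ‖(start N α : Amp V A)‖ = 1) {x y : ℝ}
    {ψ : Reg V A} (hψ : ψ.1 = (x : ℂ) • goodPart B t vis k N α + (y : ℂ) • badPart B t vis k N α)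
    {σ : ℝ} (hσ : ‖goodPart B t vis k N α‖ ^ 2 = σ) :
    (evolve B vis (groverIteration t k N α) ψ).1 =
      ((2 * (y * (1 - σ) - x * σ) + x : ℝ) : ℂ) • goodPart B t vis k N α +
      ((2 * (y * (1 - σ) - x * σ) - y : ℝ) : ℂ) • badPart B t vis k N α := by
  have hg : inner ℂ (start N α : Amp V A) (goodPart B t vis k N α) = (σ : ℂ) := by
    rw [inner_start_goodPart, hσ]
  have hb : inner ℂ (start N α : Amp V A) (badPart B t vis k N α) = (1 - σ : ℂ) := by
    rw [← hg, eq_sub_iff_add_eq', ← inner_add_right, goodPart_add_badPart,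
      inner_self_eq_norm_sq_to_K, hs]
    simp
  simp only [groverIteration, evolve]
  rw [hψ, op_query_evaluation_parts, op_reflect hs, inner_add_right, inner_smul_right,
    inner_smul_right, hg, hb, ← goodPart_add_badPart (B := B) (t := t) (vis := vis) (k := k) N α]
  push_cast
  module

/-- One iteration is a rotation by `2θ`. The coefficients refer to unnormalised parts, of norms
`|sin θ|` and `|cos θ|`; stating the products avoids dividing by a sine or cosine that may vanish.
-/
theorem evolve_replicate {N : ℕ} {α : ℝ} (hs : ‖(start N α : Amp V A)‖ = 1) {θ : ℝ}
    (hθ : ‖goodPart B t vis k N α‖ ^ 2 = Real.sin θ ^ 2) {ψ : Reg V A} (hψ : ψ.1 = start N α)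
    (n : ℕ) : ∃ x y : ℝ, x * Real.sin θ = Real.sin ((2 * n + 1) * θ) ∧
      y * Real.cos θ = Real.cos ((2 * n + 1) * θ) ∧
      (evolve B vis (List.replicate n (groverIteration t k N α)).flatten ψ).1 =
        (x : ℂ) • goodPart B t vis k N α + (y : ℂ) • badPart B t vis k N α := by
  induction n with
  | zero =>
    refine ⟨1, 1, by simp, by simp, ?_⟩
    simp [evolve, hψ, goodPart_add_badPart]
  | succ n ih =>
    obtain ⟨x, y, hx, hy, h⟩ := ih
    rw [List.replicate_succ', List.flatten_append, evolve_append]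
    rw [List.flatten_singleton]
    refine ⟨_, _, ?_, ?_, evolve_groverIteration hs h hθ⟩
    all_goals
      have h1 : (2 * ((n + 1 : ℕ) : ℝ) + 1) * θ = (2 * n + 1) * θ + 2 * θ := by push_cast; ring
      have h2 := Real.sin_sq_add_cos_sq θ
      have h3 : 1 - Real.sin θ ^ 2 = Real.cos θ ^ 2 := by linarith
      rw [h1, h3]
    · rw [Real.sin_add, Real.sin_two_mul, Real.cos_two_mul', ← hx, ← hy]
      linear_combination (-Real.sin θ * x) * h2
    · rw [Real.cos_add, Real.sin_two_mul, Real.cos_two_mul', ← hx, ← hy]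
      linear_combination (Real.cos θ * y) * h2

end Iteration

section Gates

variable {V : ℕ} {A : Type}

theorem length_groverIterations (t : Fin V → A → Option (Fin V)) (k : Fin V) (N : ℕ) (α : ℝ) (n : ℕ) :
    (List.replicate n (groverIteration t k N α)).flatten.length = 6 * n := by
  simp [groverIteration, mul_comm]

theorem expect_born [Fintype A] (ψ : Reg V A) (f : Basis V A → ℝ≥0∞) :
    expect (born ψ) f = ∑ b, ENNReal.ofReal (‖ψ.1 b‖ ^ 2) * f b := by
  simp [expect_fintype, born]

/-- The outcome of the evaluation of a search at an index. -/
def evalResult (B : BlackBox V A) (t : Fin V → A → Option (Fin V)) (vis : Fin V → Bool)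
    (k j : Fin V) : Option (Fin V) :=
  match t j (B.query k j) with
  | none => none
  | some v => if vis v then none else some v

theorem noneInd_evalResult (B : BlackBox V A) (t : Fin V → A → Option (Fin V)) (vis : Fin V → Bool)
    (k j : Fin V) :
    noneInd (evalResult B t vis k j) = if unvisited t vis j (B.query k j) then 0 else 1 := by
  unfold evalResult unvisited
  cases h : t j (B.query k j) with
  | none => simp [noneInd]
  | some v => cases h' : vis v <;> simp [noneInd, h']

end Gates

section Grover

variable {V : ℕ} {A : Type} [Fintype A] [NeZero V] [AddCommGroup A] {B : BlackBox V A}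
  {t : Fin V → A → Option (Fin V)} {vis : Fin V → Bool} {k : Fin V}

theorem run_evalF (k j : Fin V) (s : Machine V A) : ∃ τ ≤ 2,
    run B (evalF t k j) s =
      PMF.pure (evalResult B t s.vis k j, { s with time := s.time + τ }) := by
  unfold evalF evalResult
  simp only [run]
  cases h : t j (B.query k j) with
  | none => exact ⟨1, by norm_num, by simp [run, Machine.tick]⟩
  | some v => exact ⟨2, le_rfl, by cases h' : s.vis v <;> simp [run, Machine.tick, add_assoc, h']⟩

theorem run_grover (N : ℕ) (α : ℝ) (n : ℕ) (s : Machine V A) :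
    run B (grover t k N α n) s =
      (born (evolve B s.vis (List.replicate n (groverIteration t k N α)).flatten
        (startReg N α))).bind fun b =>
      run B (evalF t k b.1) { s with time := s.time + (6 * n + 2), reg := ket b } := by
  have : grover t k N α n = .prep N α (Prog.bind' (gates (List.replicate n
      (groverIteration t k N α)).flatten) fun _ => .meas fun j => evalF t k j) := rfl
  rw [this]
  simp only [run, run_bind, run_gates, PMF.pure_bind, Machine.tick, length_groverIterations]
  congr! 4
  ring

/-- Grover's algorithm with `n` iterations, the initial state having the angle `θ` with the
subspace of unmarked states. -/
theorem isSearch_grover {α θ : ℝ} (h1 : 1 ≤ B.size k) (hV : B.size k ≤ V)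
    (hθ : ((solutions B t vis k).card : ℝ) / B.size k * Real.sin α ^ 2 = Real.sin θ ^ 2) (n : ℕ) :
    IsSearch B t vis k (grover t k (B.size k) α n) (6 * n + 4)
      (1 - Real.sin ((2 * n + 1) * θ) ^ 2) := by
  have hs := norm_start (A := A) h1 hV α
  have hr : (startReg (B.size k) α : Reg V A).1 = start (B.size k) α := by
    rw [startReg, dif_pos hs]
  have hg : ‖goodPart B t vis k (B.size k) α‖ ^ 2 = Real.sin θ ^ 2 := norm_goodPart_sq.trans hθ
  obtain ⟨x, y, hx, -, hψ⟩ := evolve_replicate hs hg hr n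
  refine ⟨by positivity, by linarith [Real.sin_sq_le_one ((2 * n + 1) * θ)], ?_, ?_, ?_⟩
  · rintro s rfl z hz
    rw [run_grover, PMF.mem_support_bind_iff] at hz
    obtain ⟨b, hb, hz⟩ := hz
    obtain ⟨τ, -, h⟩ := run_evalF (B := B) (t := t) k b.1
      { s with time := s.time + (6 * n + 2), reg := ket b }
    rw [h, PMF.support_pure, Set.mem_singleton_iff] at hz
    subst hz
    refine ⟨rfl, rfl, fun v hv => ⟨b.1, ?_, ?_⟩⟩
    -- The state stays in the span of the two parts, which vanish outside the domain, so such an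
    -- index has probability zero.
    · by_contra hlt
      rw [PMF.mem_support_iff] at hb
      apply hb
      have h0 : (start (B.size k) α : Amp V A) b = 0 := start_eq_zero fun h => hlt h.1
      simp [born, hψ, goodPart, badPart, h0]
    · simp only [evalResult] at hv
      cases h' : t b.1 (B.query k b.1) with
      | none => simp [h'] at hv
      | some w =>
        cases hw : s.vis w <;> simp [h', hw] at hv
        subst hv
        exact ⟨rfl, hw⟩
  · rintro s rfl
    rw [run_grover, expect_bind]
    refine (expect_mono fun b => ?_).trans (expect_const _ _).le
    obtain ⟨τ, hτ, h⟩ := run_evalF (B := B) (t := t) k b.1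
      { s with time := s.time + (6 * n + 2), reg := ket b }
    rw [h, expect_pure]
    have : (6 * n + 4 : ℝ) = ((6 * n + 4 : ℕ) : ℝ) := by push_cast; ring
    rw [this, ENNReal.ofReal_natCast]
    norm_cast
    dsimp only
    omega
  · rintro s rfl
    rw [run_grover, expect_bind, expect_born]
    set ψ := evolve B s.vis (List.replicate n (groverIteration t k (B.size k) α)).flatten
      (startReg (B.size k) α) with hψdef
    -- Both sides vanish at marked states; at unmarked ones the good part is zero. Only an
    -- inequality holds, since a state with the auxiliary qubit off is unmarked but may still show a
    -- solution.
    have hbound : ∀ b : Basis V A, (‖ψ.1 b‖ ^ 2 : ℝ) *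
        (if unvisited t s.vis b.1 (B.query k b.1) then 0 else 1) ≤
        ‖ψ.1 b‖ ^ 2 - x ^ 2 * ‖goodPart B t s.vis k (B.size k) α b‖ ^ 2 := by
      intro b
      rw [hψ]
      by_cases hm : marked B t s.vis k b = true
      · have hu : unvisited t s.vis b.1 (B.query k b.1) = true := by
          simp only [marked, Bool.and_eq_true] at hm
          exact hm.1
        simp [hu, goodPart, badPart, hm, mul_pow]
      · simp only [goodPart, badPart, hm]
        split_ifs <;> simp_all; positivity
    have hsum : ∑ b : Basis V A, (‖ψ.1 b‖ ^ 2 -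
        x ^ 2 * ‖goodPart B t s.vis k (B.size k) α b‖ ^ 2) =
        1 - Real.sin ((2 * n + 1) * θ) ^ 2 := by
      rw [Finset.sum_sub_distrib, ← Finset.mul_sum, ← EuclideanSpace.norm_sq_eq,
        ← EuclideanSpace.norm_sq_eq, hg, ψ.2, ← mul_pow, hx, one_pow]
    rw [← hsum]
    calc _ = ∑ b : Basis V A, ENNReal.ofReal ((‖ψ.1 b‖ ^ 2 : ℝ) *
        (if unvisited t s.vis b.1 (B.query k b.1) then 0 else 1)) := by
          refine Finset.sum_congr rfl fun b _ => ?_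
          obtain ⟨τ, -, h⟩ := run_evalF (B := B) (t := t) k b.1
            { s with time := s.time + (6 * n + 2), reg := ket b }
          rw [h, expect_pure, noneInd_evalResult, ENNReal.ofReal_mul (by positivity)]
          split_ifs <;> simp
      _ = ENNReal.ofReal (∑ b : Basis V A, (‖ψ.1 b‖ ^ 2 : ℝ) *
        (if unvisited t s.vis b.1 (B.query k b.1) then 0 else 1)) := by
          rw [ENNReal.ofReal_sum_of_nonneg]
          intro b _
          split_ifs <;> simp
      _ ≤ _ := ENNReal.ofReal_le_ofReal (Finset.sum_le_sum fun b _ => hbound b)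

theorem IsSearch.rand {n : ℕ} {P : Fin (n + 1) → Prog V A (Option (Fin V))} {c : ℝ}
    {p : Fin (n + 1) → ℝ} (h : ∀ j, IsSearch B t vis k (P j) c (p j)) :
    IsSearch B t vis k (.rand n P) (c + 1) ((∑ j, p j) / (n + 1)) where
  cost_nonneg := add_nonneg (h 0).cost_nonneg zero_le_one
  fail_nonneg := div_nonneg (Finset.sum_nonneg fun j _ => (h j).fail_nonneg) (by positivity)
  sound s hs x hx := by
    rw [run, PMF.mem_support_bind_iff] at hx
    obtain ⟨j, -, hx⟩ := hx
    exact (h j).sound s.tick hs x hx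
  time s hs := by
    rw [run, expect_bind]
    refine (expect_mono fun j => (h j).time s.tick hs).trans ?_
    rw [expect_const, ENNReal.ofReal_add (h 0).cost_nonneg zero_le_one]
    simp only [Machine.tick]
    push_cast
    rw [ENNReal.ofReal_one, add_right_comm, ← add_assoc]
  fail s hs := by
    rw [run, expect_bind]
    refine (expect_mono fun j => (h j).fail s.tick hs).trans ?_
    rw [expect_fintype, ENNReal.ofReal_div_of_pos (by positivity),
      ENNReal.ofReal_sum_of_nonneg fun j _ => (h j).fail_nonneg, div_eq_mul_inv, mul_comm,
      Finset.mul_sum]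
    refine (Finset.sum_congr rfl fun j _ => ?_).le
    rw [PMF.uniformOfFintype_apply, Fintype.card_fin]
    congr 2
    rw [ENNReal.ofReal_add (by positivity) zero_le_one]
    simp

end Grover

/-! ### Grover's algorithm with a random number of iterations -/

/-- A telescoping sum: 2 sin 2θ cos (2(2j+1)θ) = sin (4(j+1)θ) - sin (4jθ). -/
theorem sum_sin_sq (θ : ℝ) (r : ℕ) :
    4 * Real.sin (2 * θ) * ∑ j ∈ Finset.range r, Real.sin ((2 * j + 1) * θ) ^ 2 =
      2 * r * Real.sin (2 * θ) - Real.sin (4 * r * θ) := by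
  induction r with
  | zero => simp
  | succ r ih =>
    rw [Finset.sum_range_succ, mul_add, ih, Real.sin_sq_eq_half_sub]
    have h1 : 4 * ((r + 1 : ℕ) : ℝ) * θ = 2 * ((2 * r + 1) * θ) + 2 * θ := by push_cast; ring
    have h2 : 4 * (r : ℝ) * θ = 2 * ((2 * r + 1) * θ) - 2 * θ := by ring
    rw [h1, h2, Real.sin_add, Real.sin_sub]
    push_cast
    ring

theorem sum_cos_sq (θ : ℝ) (r : ℕ) :
    4 * Real.sin (2 * θ) * ∑ j ∈ Finset.range r, Real.cos ((2 * j + 1) * θ) ^ 2 =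
      2 * r * Real.sin (2 * θ) + Real.sin (4 * r * θ) := by
  have h := sum_sin_sq θ r
  simp only [Real.cos_sq', Finset.sum_sub_distrib, Finset.sum_const, Finset.card_range,
    nsmul_eq_mul, mul_one, mul_sub]
  linarith

theorem sin_sq_odd_mul_pi_div_two_sub (δ : ℝ) (j : ℕ) :
    Real.sin ((2 * j + 1) * (Real.pi / 2 - δ)) ^ 2 = Real.cos ((2 * j + 1) * δ) ^ 2 := by
  have h : (2 * j + 1) * (Real.pi / 2 - δ) = (Real.pi / 2 - (2 * j + 1) * δ) + j * Real.pi := by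
    ring
  rw [h, Real.sin_add_nat_mul_pi, mul_pow, ← pow_mul, mul_comm j, pow_mul, neg_one_sq, one_pow,
    one_mul, Real.sin_pi_div_two_sub]

/-- A random number of iterations succeeds with probability at least one quarter. -/
theorem quarter_le_sum_sin_sq {θ : ℝ} (h0 : 0 < θ) (h1 : θ ≤ Real.pi / 2) {r : ℕ}
    (hr : 1 ≤ r * Real.sin θ) :
    (r : ℝ) / 4 ≤ ∑ j ∈ Finset.range r, Real.sin ((2 * j + 1) * θ) ^ 2 := by
  have hpi := Real.pi_pos
  -- Up to π/4, sin 2θ ≥ sin θ, so the oscillating term is at most 1 ≤ r sin 2θ, half of the main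
  -- term. Beyond π/4 this comparison can fail, and one passes to the complementary angle.
  rcases le_or_gt θ (Real.pi / 4) with h | h
  · have hs : 0 < Real.sin (2 * θ) := Real.sin_pos_of_pos_of_lt_pi (by linarith) (by linarith)
    have hle : Real.sin θ ≤ Real.sin (2 * θ) :=
      Real.sin_le_sin_of_le_of_le_pi_div_two (by linarith) (by linarith) (by linarith)
    have h2 := sum_sin_sq θ r
    have h3 := Real.sin_le_one (4 * r * θ)
    have h4 : (r : ℝ) * Real.sin θ ≤ r * Real.sin (2 * θ) := by gcongr
    by_contra! hc
    nlinarith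
  · obtain ⟨δ, rfl⟩ : ∃ δ, θ = Real.pi / 2 - δ := ⟨Real.pi / 2 - θ, by ring⟩
    simp only [sin_sq_odd_mul_pi_div_two_sub]
    rcases eq_or_lt_of_le (show 0 ≤ δ by linarith) with rfl | hδ
    · simp
      linarith [(Nat.cast_nonneg r : (0 : ℝ) ≤ r)]
    have hs : 0 < Real.sin (2 * δ) := Real.sin_pos_of_pos_of_lt_pi (by linarith) (by linarith)
    have h2 := sum_cos_sq δ r
    -- Either the second sine is nonnegative, or `4rδ > π` and Jordan's inequality gives r sin 2δ ≥
    -- 4rδ/π ≥ 1.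
    have h3 : 0 ≤ r * Real.sin (2 * δ) + Real.sin (4 * r * δ) := by
      rcases le_or_gt (4 * r * δ) Real.pi with h5 | h5
      · have := Real.sin_nonneg_of_nonneg_of_le_pi (x := 4 * r * δ) (by positivity) h5
        positivity
      · have h6 : 2 / Real.pi * (2 * δ) ≤ Real.sin (2 * δ) :=
          Real.mul_le_sin (by linarith) (by linarith)
        have h7 : 1 ≤ r * (2 / Real.pi * (2 * δ)) := by
          rw [show r * (2 / Real.pi * (2 * δ)) = 4 * r * δ / Real.pi by ring, le_div_iff₀ hpi]
          linarith
        have h8 : r * (2 / Real.pi * (2 * δ)) ≤ r * Real.sin (2 * δ) := by gcongr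
        linarith [Real.neg_one_le_sin (4 * r * δ)]
    by_contra! hc
    nlinarith

theorem exists_sin_sq_eq {x : ℝ} (h0 : 0 ≤ x) (h1 : x ≤ 1) : ∃ θ, x = Real.sin θ ^ 2 := by
  refine ⟨Real.arcsin (Real.sqrt x), ?_⟩
  rw [Real.sin_arcsin (by linarith [Real.sqrt_nonneg x]) (Real.sqrt_le_one.2 h1), Real.sq_sqrt h0]

/-! ### Proportion of solutions, number of rounds, and elementary sums -/

section Solutions

variable {V : ℕ} {A : Type} {B : BlackBox V A} {t : Fin V → A → Option (Fin V)}
  {vis : Fin V → Bool} {k : Fin V}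

theorem card_solutions_le (hV : B.size k ≤ V) : (solutions B t vis k).card ≤ B.size k := by
  rw [← card_lt (V := V) hV]
  exact Finset.card_le_card fun j hj => by simp_all [solutions]

theorem sin_arcsin_sqrt_card (hV : B.size k ≤ V) :
    Real.sin (Real.arcsin (Real.sqrt ((solutions B t vis k).card / B.size k))) =
      Real.sqrt ((solutions B t vis k).card / B.size k) := by
  refine Real.sin_arcsin (by linarith [Real.sqrt_nonneg ((solutions B t vis k).card / B.size k)]) ?_
  rw [Real.sqrt_le_one]
  exact div_le_one_of_le₀ (by exact_mod_cast card_solutions_le hV) (by positivity)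

theorem one_le_sqrt_size_div (hV : B.size k ≤ V) (hM : 0 < (solutions B t vis k).card) :
    1 ≤ Real.sqrt (B.size k / (solutions B t vis k).card) := by
  rw [Real.one_le_sqrt, one_le_div (by exact_mod_cast hM)]
  exact_mod_cast card_solutions_le hV

end Solutions

theorem exists_bbhtRounds (N : ℕ) : ∃ c : ℕ, 2 * Real.sqrt N < (8 / 7 : ℝ) ^ c :=
  pow_unbounded_of_one_lt _ (by norm_num)

theorem lt_pow_bbhtRounds (N : ℕ) : 2 * Real.sqrt N < (8 / 7 : ℝ) ^ bbhtRounds N :=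
  Nat.sInf_mem (s := {c : ℕ | 2 * Real.sqrt N < (8 / 7 : ℝ) ^ c}) (exists_bbhtRounds N)

theorem pow_le_of_lt_bbhtRounds {N c : ℕ} (h : c < bbhtRounds N) :
    (8 / 7 : ℝ) ^ c ≤ 2 * Real.sqrt N :=
  not_lt.1 fun h' => Nat.notMem_of_lt_sInf h h'

theorem bbhtRounds_zero : bbhtRounds 0 = 0 := by
  rw [bbhtRounds, Nat.sInf_eq_zero]
  simp

theorem geom_sum_eight_sevenths (n : ℕ) :
    ∑ i ∈ Finset.range n, (8 / 7 : ℝ) ^ i = 7 * ((8 / 7) ^ n - 1) := by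
  rw [geom_sum_eq (by norm_num)]
  ring

/-- With a = √(M+1) and b = √M, so that a² - b² = 1, the claim 1 ≤ 2a(a - b) is (a - b)² ≥ 0. -/
theorem sqrt_div_le (N : ℝ) (M : ℕ) :
    Real.sqrt (N / (M + 1 : ℕ)) ≤ 2 * (Real.sqrt (N * (M + 1 : ℕ)) - Real.sqrt (N * M)) := by
  rw [Real.sqrt_div' _ (by positivity), Real.sqrt_mul' _ (by positivity),
    Real.sqrt_mul' _ (by positivity), ← mul_sub, div_eq_mul_inv, mul_left_comm]
  refine mul_le_mul_of_nonneg_left ?_ (Real.sqrt_nonneg _)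
  have h1 : Real.sqrt (M + 1 : ℕ) ^ 2 = M + 1 := by
    rw [Real.sq_sqrt (by positivity)]; push_cast; rfl
  have h2 : Real.sqrt M ^ 2 = M := Real.sq_sqrt (by positivity)
  have h3 : 0 < Real.sqrt (M + 1 : ℕ) := Real.sqrt_pos.2 (by positivity)
  rw [inv_le_iff_one_le_mul₀ h3]
  nlinarith [sq_nonneg (Real.sqrt (M + 1 : ℕ) - Real.sqrt M)]

theorem sum_sqrt_div_le (N K : ℕ) :
    ∑ i ∈ Finset.range K, Real.sqrt (N / (i + 1 : ℕ)) ≤ 2 * Real.sqrt (N * K) := by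
  induction K with
  | zero => simp
  | succ K ih =>
    rw [Finset.sum_range_succ]
    linarith [sqrt_div_le N K]

section Search

variable {V : ℕ} {A : Type} [Fintype A] [NeZero V] [AddCommGroup A] {B : BlackBox V A}
  {t : Fin V → A → Option (Fin V)} {vis : Fin V → Bool} {k : Fin V}

/-- The condition √(N/M) ≤ m says that ⌈m⌉ sin θ ≥ 1, the hypothesis of `quarter_le_sum_sin_sq`. The
iteration count is at most ⌈m⌉ - 1 ≤ m. -/
theorem isSearch_randomGrover (h1 : 1 ≤ B.size k) (hV : B.size k ≤ V) {m : ℝ} (hm : 0 < m) :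
    IsSearch B t vis k (randomGrover t k (B.size k) m) (6 * m + 5)
      (if 0 < (solutions B t vis k).card ∧
        Real.sqrt (B.size k / (solutions B t vis k).card) ≤ m then 3 / 4 else 1) := by
  set M := (solutions B t vis k).card with hM
  set θ := Real.arcsin (Real.sqrt (M / B.size k)) with hθ
  have hsin : Real.sin θ = Real.sqrt (M / B.size k) := sin_arcsin_sqrt_card hV
  have hc : 0 < ⌈m⌉₊ := Nat.ceil_pos.2 hm
  have hr : ((⌈m⌉₊ - 1 : ℕ) : ℝ) + 1 = ⌈m⌉₊ := by
    rw [Nat.cast_sub hc]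
    simp
  have hlt : ((⌈m⌉₊ - 1 : ℕ) : ℝ) ≤ m := by linarith [Nat.ceil_lt_add_one hm.le]
  have hj : ∀ j : Fin (⌈m⌉₊ - 1 + 1), IsSearch B t vis k
      (grover t k (B.size k) (Real.pi / 2) j) (6 * m + 4)
      (1 - Real.sin ((2 * (j : ℕ) + 1) * θ) ^ 2) := by
    intro j
    refine (isSearch_grover h1 hV ?_ _).mono ?_ le_rfl
    · rw [Real.sin_pi_div_two, one_pow, mul_one, hsin, Real.sq_sqrt (by positivity)]
    · have : ((j : ℕ) : ℝ) ≤ ((⌈m⌉₊ - 1 : ℕ) : ℝ) := by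
        exact_mod_cast Nat.lt_succ_iff.1 j.2
      linarith
  refine (IsSearch.rand hj).mono (by linarith) ?_
  rw [hr, div_le_iff₀ (by exact_mod_cast hc)]
  have hsum : ∑ j : Fin (⌈m⌉₊ - 1 + 1), (1 - Real.sin ((2 * (j : ℕ) + 1) * θ) ^ 2) =
      ⌈m⌉₊ - ∑ j ∈ Finset.range ⌈m⌉₊, Real.sin ((2 * j + 1) * θ) ^ 2 := by
    rw [Fin.sum_univ_eq_sum_range (fun j : ℕ => 1 - Real.sin ((2 * (j : ℝ) + 1) * θ) ^ 2),
      Nat.sub_add_cancel hc]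
    simp
  rw [hsum]
  split_ifs with h
  · obtain ⟨hM0, hle⟩ := h
    have hN0 : (0 : ℝ) < B.size k := by exact_mod_cast h1
    have hM0' : (0 : ℝ) < M := by exact_mod_cast hM0
    have := quarter_le_sum_sin_sq (θ := θ) (r := ⌈m⌉₊)
      (Real.arcsin_pos.2 (Real.sqrt_pos.2 (by positivity))) (Real.arcsin_le_pi_div_two _) (by
        rw [hsin]
        calc (1 : ℝ) = Real.sqrt (B.size k / M) * Real.sqrt (M / B.size k) := by
              rw [← Real.sqrt_mul (by positivity), div_mul_div_cancel₀ hM0'.ne',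
                div_self hN0.ne', Real.sqrt_one]
          _ ≤ _ := by
              gcongr
              exact hle.trans (Nat.le_ceil m))
    linarith
  · have : 0 ≤ ∑ j ∈ Finset.range ⌈m⌉₊, Real.sin ((2 * j + 1) * θ) ^ 2 :=
      Finset.sum_nonneg fun j _ => by positivity
    linarith

/-! ### The search algorithms BBHT, BCWZ and findsol -/

/-- A crude form: the costs of the listed programs are added without weighting them by the
probability of being reached. -/
theorem IsSearch.firstSome_map_append {Ps : List (Prog V A (Option (Fin V)))} {ι : Type}
    {f g : ι → ℝ} {P : ι → Prog V A (Option (Fin V))} (l : List ι)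
    (hP : ∀ i ∈ l, IsSearch B t vis k (P i) (f i) (g i)) (hg : ∀ i ∈ l, g i ≤ 1)
    {c p : ℝ} (hPs : IsSearch B t vis k (firstSome Ps) c p) :
    IsSearch B t vis k (firstSome (l.map P ++ Ps)) ((l.map f).sum + c) ((l.map g).prod * p) := by
  induction l with
  | nil => simpa using hPs
  | cons i l ih =>
    simp only [List.map_cons, List.cons_append, List.sum_cons, List.prod_cons]
    have h := ih (fun j hj => hP j (by simp [hj])) fun j hj => hg j (by simp [hj])
    refine ((hP i (by simp)).firstSome_cons h).mono ?_ (mul_assoc _ _ _).ge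
    rw [add_assoc]
    gcongr
    exact mul_le_of_le_one_left h.cost_nonneg (hg i (by simp))

theorem isSearch_round (h1 : 1 ≤ B.size k) (hV : B.size k ≤ V) (c : ℕ) :
    IsSearch B t vis k (randomGrover t k (B.size k) ((8 / 7) ^ c)) (11 * (8 / 7) ^ c)
      (if 0 < (solutions B t vis k).card ∧
        Real.sqrt (B.size k / (solutions B t vis k).card) ≤ (8 / 7) ^ c then 3 / 4 else 1) :=
  (isSearch_randomGrover h1 hV (by positivity)).mono
    (by linarith [one_le_pow₀ (n := c) (show (1 : ℝ) ≤ 8 / 7 by norm_num)]) le_rfl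

/-- Serves the case without solutions, where every round is run. The last length is at most 2√N, so
the geometric sum is at most 77 · (16/7) √N = 176 √N. An empty domain has no rounds. -/
theorem isSearch_bbht_worst (hV : B.size k ≤ V) :
    IsSearch B t vis k (bbht t k (B.size k)) (176 * Real.sqrt (B.size k)) 1 := by
  rcases Nat.eq_zero_or_pos (B.size k) with h0 | h1
  · rw [bbht, h0, bbhtRounds_zero]
    simpa using isSearch_firstSome_nil (B := B) (t := t) (vis := vis) (k := k)
  have hle : ∀ r, r ≤ bbhtRounds (B.size k) → (r = 0 ∨ (8 / 7 : ℝ) ^ r ≤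
      16 / 7 * Real.sqrt (B.size k)) := by
    intro r hr
    rcases r with _ | r
    · simp
    · right
      have := pow_le_of_lt_bbhtRounds (Nat.lt_of_succ_le hr)
      rw [pow_succ]
      linarith
  have hround : ∀ c ∈ List.range (bbhtRounds (B.size k)), IsSearch B t vis k
      (randomGrover t k (B.size k) ((8 / 7) ^ c)) (11 * (8 / 7) ^ c) 1 := fun c _ =>
    (isSearch_round (t := t) (vis := vis) h1 hV c).mono le_rfl (by split_ifs <;> norm_num)
  have := IsSearch.firstSome_map_append _ hround (fun _ _ => le_rfl) isSearch_firstSome_nil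
  rw [List.append_nil] at this
  refine this.mono ?_ (by simp)
  have hsum : ((List.range (bbhtRounds (B.size k))).map fun c => 11 * (8 / 7 : ℝ) ^ c).sum =
      ∑ c ∈ Finset.range (bbhtRounds (B.size k)), 11 * (8 / 7 : ℝ) ^ c := rfl
  rw [hsum, ← Finset.mul_sum, geom_sum_eight_sevenths, add_zero]
  rcases hle _ le_rfl with h | h
  · rw [h]
    simp
  · linarith

/-- From the critical round `c₀` on, 77 (8/7)^c reproduces itself, because 11 + (3/4)(8/7) · 77 =
77. Before it no success is assumed, and the bound adds the costs of the rounds up to `c₀` to 77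
(8/7)^c₀. The exponent of 3/4 counts the remaining rounds that are not before `c₀`. -/
theorem isSearch_rounds (h1 : 1 ≤ B.size k) (hV : B.size k ≤ V) {c₀ : ℕ}
    (hM : 0 < (solutions B t vis k).card)
    (hc : ∀ c, c₀ ≤ c → Real.sqrt (B.size k / (solutions B t vis k).card) ≤ (8 / 7) ^ c)
    (n c : ℕ) : IsSearch B t vis k
      (firstSome ((List.range' c n).map fun c => randomGrover t k (B.size k) ((8 / 7 : ℝ) ^ c)))
      (if c₀ ≤ c then 77 * (8 / 7) ^ c else 154 * (8 / 7) ^ c₀ - 77 * (8 / 7) ^ c)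
      ((3 / 4) ^ (n - (c₀ - c))) := by
  induction n generalizing c with
  | zero =>
    refine isSearch_firstSome_nil.mono ?_ (by simp)
    split_ifs with h
    · positivity
    · have : (8 / 7 : ℝ) ^ c ≤ (8 / 7) ^ c₀ := pow_le_pow_right₀ (by norm_num) (by omega)
      have h0 : (0 : ℝ) < (8 / 7) ^ c := by positivity
      linarith
  | succ n ih =>
    rw [List.range'_succ, List.map_cons]
    have hr := isSearch_round (t := t) (vis := vis) h1 hV c
    have hp : (0 : ℝ) < (8 / 7) ^ c := by positivity
    by_cases h : c₀ ≤ c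
    · rw [if_pos ⟨hM, hc c h⟩] at hr
      refine (hr.firstSome_cons (ih (c + 1))).mono ?_ ?_
      · rw [if_pos h, if_pos (by omega), pow_succ]
        linarith
      · rw [← pow_succ']
        refine (congrArg _ ?_).le
        omega
    · refine ((hr.mono le_rfl (show _ ≤ (1 : ℝ) by split_ifs <;> norm_num)).firstSome_cons
        (ih (c + 1))).mono ?_ ?_
      · rw [if_neg h]
        by_cases h' : c₀ ≤ c + 1
        · obtain rfl : c₀ = c + 1 := by omega
          rw [if_pos le_rfl, pow_succ]
          linarith
        · rw [if_neg h', pow_succ]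
          linarith
      · rw [one_mul]
        refine (congrArg _ ?_).le
        omega

theorem isSearch_bbht (hV : B.size k ≤ V) (hM : 0 < (solutions B t vis k).card) :
    IsSearch B t vis k (bbht t k (B.size k))
      (176 * Real.sqrt (B.size k / (solutions B t vis k).card))
      ((solutions B t vis k).card : ℝ)⁻¹ := by
  classical
  have h1 : 1 ≤ B.size k := hM.trans_le (card_solutions_le hV)
  have hone := one_le_sqrt_size_div hV hM
  set M := (solutions B t vis k).card
  have hex : ∃ c : ℕ, Real.sqrt (B.size k / M) ≤ (8 / 7) ^ c :=
    (pow_unbounded_of_one_lt _ (by norm_num)).imp fun _ h => h.le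
  -- The least sufficient length overshoots √(N/M) by a factor of at most 8/7, whence 154 · 8/7 =
  -- 176.
  obtain ⟨c₀, h₀, hmin⟩ : ∃ c₀ : ℕ, Real.sqrt (B.size k / M) ≤ (8 / 7) ^ c₀ ∧
      (8 / 7 : ℝ) ^ c₀ ≤ 8 / 7 * Real.sqrt (B.size k / M) := by
    refine ⟨Nat.find hex, Nat.find_spec hex, ?_⟩
    rcases hfind : Nat.find hex with _ | c
    · linarith
    · have := not_le.1 (Nat.find_min hex (m := c) (by omega))
      rw [pow_succ]
      linarith
  have hM' : (0 : ℝ) < M := by exact_mod_cast hM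
  have hsq : Real.sqrt (B.size k / M) * Real.sqrt M = Real.sqrt (B.size k) := by
    rw [← Real.sqrt_mul (by positivity), div_mul_cancel₀ _ hM'.ne']
  have hMs : 1 ≤ Real.sqrt M := Real.one_le_sqrt.2 (by exact_mod_cast hM)
  have hrounds := lt_pow_bbhtRounds (B.size k)
  have hlt : c₀ ≤ bbhtRounds (B.size k) := by
    refine ((pow_lt_pow_iff_right₀ (show (1 : ℝ) < 8 / 7 by norm_num)).1 ?_).le
    nlinarith
  have h := isSearch_rounds (n := bbhtRounds (B.size k)) (c := 0) h1 hV hM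
    fun c hc => h₀.trans (pow_le_pow_right₀ (by norm_num) hc)
  rw [bbht, List.range_eq_range']
  refine h.mono ?_ ?_
  · split_ifs
    all_goals
      simp only [pow_zero]
      linarith
  · obtain ⟨n, hn⟩ := Nat.exists_eq_add_of_le hlt
    rw [hn, pow_add] at hrounds
    rw [Nat.sub_zero, hn, Nat.add_sub_cancel_left]
    -- The lengths start near √(N/M) and end beyond 2√N, so they grow by at least √M after the
    -- critical round.
    have hq : Real.sqrt M ≤ (8 / 7) ^ n := by
      have : (8 / 7 : ℝ) ^ c₀ * (8 / 7) ^ n ≤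
          8 / 7 * Real.sqrt (B.size k / M) * (8 / 7) ^ n := by gcongr
      by_contra! hc
      nlinarith
    -- The choice 8/7 pays off here: 3/4 ≤ (7/8)² turns growth by √M into failure probability 1/M.
    calc (3 / 4 : ℝ) ^ n ≤ ((7 / 8) ^ 2) ^ n := by gcongr; norm_num
      _ = (((8 / 7) ^ n) ^ 2)⁻¹ := by
          rw [← pow_mul, ← pow_mul, ← inv_pow, mul_comm]
          norm_num
      _ ≤ (Real.sqrt M ^ 2)⁻¹ := by gcongr
      _ = _ := by rw [Real.sq_sqrt hM'.le]

/-- For exactly `M` solutions the reduced angle π/(4n+2), multiplied by 2n+1, is π/2, so the final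
state is entirely marked. The cost follows from θ ≥ √(M/N). -/
theorem isSearch_exactSearch (hV : B.size k ≤ V) {M : ℕ} (hM : 1 ≤ M) (hMN : M ≤ B.size k) :
    IsSearch B t vis k (exactSearch t k (B.size k) M) (12 * Real.sqrt (B.size k / M))
      (if (solutions B t vis k).card = M then 0 else 1) := by
  have h1 : 1 ≤ B.size k := hM.trans hMN
  have hN' : (0 : ℝ) < B.size k := by exact_mod_cast h1
  have hM' : (0 : ℝ) < M := by exact_mod_cast hM
  have hpi := Real.pi_pos
  rw [exactSearch]
  set θ := Real.arcsin (Real.sqrt (M / B.size k)) with hθ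
  set n := ⌈Real.pi / (4 * θ) - 1 / 2⌉₊ with hn
  set α := Real.arcsin (Real.sin (Real.pi / (4 * n + 2)) / Real.sin θ) with hα
  have hone : 1 ≤ Real.sqrt (B.size k / M) := by
    rw [Real.one_le_sqrt, one_le_div hM']
    exact_mod_cast hMN
  have hsq : Real.sqrt (B.size k / M) * Real.sqrt (M / B.size k) = 1 := by
    rw [← Real.sqrt_mul (by positivity), div_mul_div_cancel₀ hM'.ne', div_self hN'.ne',
      Real.sqrt_one]
  have hs0 : 0 < Real.sqrt (M / B.size k) := Real.sqrt_pos.2 (by positivity)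
  have hsin : Real.sin θ = Real.sqrt (M / B.size k) :=
    Real.sin_arcsin (by linarith) (by nlinarith)
  have hθ0 : 0 < θ := Real.arcsin_pos.2 hs0
  have hθ1 : θ ≤ Real.pi / 2 := Real.arcsin_le_pi_div_two _
  have hle : Real.sqrt (M / B.size k) ≤ θ := hsin ▸ Real.sin_le hθ0.le
  have hcost : 6 * (n : ℝ) + 4 ≤ 12 * Real.sqrt (B.size k / M) := by
    have h2 : 0 ≤ Real.pi / (4 * θ) - 1 / 2 := by
      rw [sub_nonneg, div_le_div_iff₀ (by norm_num) (by positivity)]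
      linarith
    have h3 := Nat.ceil_lt_add_one h2
    have h4 : Real.pi / (4 * θ) ≤ Real.pi / 4 * Real.sqrt (B.size k / M) := by
      rw [div_le_iff₀ (by positivity)]
      calc Real.pi = Real.pi / 4 * Real.sqrt (B.size k / M) *
            (4 * Real.sqrt (M / B.size k)) := by linear_combination (-Real.pi) * hsq
        _ ≤ _ := by gcongr
    have h5 : Real.pi / 4 * Real.sqrt (B.size k / M) ≤ 3.15 / 4 * Real.sqrt (B.size k / M) := by
      gcongr
      exact Real.pi_lt_d2.le
    linarith
  split_ifs with hc
  -- Rounding `n` up makes the target angle no larger than `θ`, so the ratio of sines lies in the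
  -- domain of `arcsin`.
  · have hn' : Real.pi / (4 * n + 2) ≤ θ := by
      have := Nat.le_ceil (Real.pi / (4 * θ) - 1 / 2)
      rw [sub_le_iff_le_add, div_le_iff₀ (by positivity)] at this
      rw [div_le_iff₀ (by positivity)]
      linarith
    have h0 : 0 ≤ Real.pi / (4 * n + 2) := by positivity
    have hratio0 : 0 ≤ Real.sin (Real.pi / (4 * n + 2)) / Real.sin θ :=
      div_nonneg (Real.sin_nonneg_of_nonneg_of_le_pi h0 (by linarith)) (by rw [hsin]; positivity)
    have hratio1 : Real.sin (Real.pi / (4 * n + 2)) / Real.sin θ ≤ 1 := by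
      rw [div_le_one (by rw [hsin]; exact hs0)]
      exact Real.sin_le_sin_of_le_of_le_pi_div_two (by linarith) hθ1 hn'
    refine (isSearch_grover (θ := Real.pi / (4 * n + 2)) h1 hV ?_ n).mono hcost ?_
    · rw [hc, hα, Real.sin_arcsin (by linarith) hratio1, div_pow, hsin,
        Real.sq_sqrt (by positivity)]
      field_simp
    · have : (2 * (n : ℝ) + 1) * (Real.pi / (4 * n + 2)) = Real.pi / 2 := by
        field_simp
        ring
      rw [this]
      simp
  -- With a different number of solutions only the cost is needed, and any angle with the right sine
  -- will do.
  · have hx : ((solutions B t vis k).card : ℝ) / B.size k * Real.sin α ^ 2 ≤ 1 :=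
      mul_le_one₀ (div_le_one_of_le₀ (by exact_mod_cast card_solutions_le hV) (by positivity))
        (by positivity) (Real.sin_sq_le_one α)
    obtain ⟨θ', h'⟩ := exists_sin_sq_eq (by positivity) hx
    exact (isSearch_grover h1 hV h' n).mono hcost
      (by linarith [sq_nonneg (Real.sin ((2 * n + 1) * θ'))])

theorem IsSearch.firstSome_replicate {P : Prog V A (Option (Fin V))} {c p : ℝ}
    (h : IsSearch B t vis k P c p) (hp : p ≤ 1) (n : ℕ) :
    IsSearch B t vis k (firstSome (List.replicate n P)) (n * c) (p ^ n) := by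
  have := IsSearch.firstSome_map_append (P := fun _ : ℕ => P) (List.range n) (fun _ _ => h)
    (fun _ _ => hp) isSearch_firstSome_nil
  simpa using this

/-- The number of exact searches, and of searches with error at most one half, in BCWZ. -/
def bcwzRounds (e : ℝ) : ℕ := ⌈Real.logb 2 e⌉₊

/-- If 0 < M ≤ T, the exact search for `M` solutions cannot fail; if M > T, the random searches are
long enough to succeed. The exact searches cost 12 · 2√(NT) and the random ones 33√(NT), which gives
57. -/
theorem isSearch_bcwz (hV : B.size k ≤ V) {e : ℝ} (he : 2 ≤ e) :
    IsSearch B t vis k (bcwz t k (B.size k) e)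
      (57 * Real.sqrt (B.size k * bcwzRounds e))
      (if 0 < (solutions B t vis k).card then e⁻¹ else 1) := by
  have hT1 : 1 ≤ bcwzRounds e := Nat.ceil_pos.2 (Real.logb_pos (by norm_num) (by linarith))
  have hTe : e ≤ 2 ^ bcwzRounds e := by
    have := Nat.le_ceil (Real.logb 2 e)
    rw [Real.logb_le_iff_le_rpow (by norm_num) (by linarith), Real.rpow_natCast] at this
    exact this
  rw [bcwz]
  change IsSearch B t vis k (firstSome (List.map _ (List.range (min (bcwzRounds e) _)) ++
    if (bcwzRounds e) < _ then List.replicate (3 * bcwzRounds e) (randomGrover t k (B.size k)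
      (Real.sqrt (B.size k / bcwzRounds e))) else [])) _ _
  set T := bcwzRounds e
  set N := B.size k with hN
  set M := (solutions B t vis k).card with hM
  have hMN : M ≤ N := card_solutions_le hV
  have hT' : (0 : ℝ) < T := by exact_mod_cast hT1
  have hrest : IsSearch B t vis k (firstSome (if T < N then List.replicate (3 * T)
      (randomGrover t k N (Real.sqrt (N / T))) else [])) (33 * Real.sqrt (N * T))
      (if T < M then e⁻¹ else 1) := by
    by_cases hTN : T < N
    · have hTN' : (T : ℝ) ≤ N := by exact_mod_cast hTN.le
      have hm1 : 1 ≤ Real.sqrt (N / T) := by rwa [Real.one_le_sqrt, one_le_div hT']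
      have h := isSearch_randomGrover (B := B) (t := t) (vis := vis) (k := k)
        (m := Real.sqrt (N / T)) (by omega) hV (by linarith)
      -- As √(N/T) ≥ 1, each run costs at most 11√(N/T), and there are 3T of them.
      have hcost : ((3 * T : ℕ) : ℝ) * (6 * Real.sqrt (N / T) + 5) ≤ 33 * Real.sqrt (N * T) := by
        have h2 : T * Real.sqrt (N / T) = Real.sqrt (N * T) := by
          rw [show (N : ℝ) * T = T ^ 2 * (N / T) by field_simp, Real.sqrt_mul (by positivity),
            Real.sqrt_sq hT'.le]
        push_cast
        nlinarith
      rw [if_pos hTN]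
      refine (h.firstSome_replicate (by split_ifs <;> norm_num) (3 * T)).mono hcost ?_
      by_cases hTM : T < M
      · have hTM' : (T : ℝ) ≤ M := by exact_mod_cast hTM.le
        rw [if_pos hTM, if_pos ⟨by omega, by gcongr⟩, pow_mul]
        -- Three runs suffice for error 1/2 because (3/4)³ = 27/64.
        calc ((3 / 4 : ℝ) ^ 3) ^ T ≤ (2⁻¹) ^ T := by gcongr; norm_num
          _ = (2 ^ T)⁻¹ := inv_pow _ _
          _ ≤ e⁻¹ := by gcongr
      · rw [if_neg hTM]
        exact pow_le_one₀ (by split_ifs <;> norm_num) (by split_ifs <;> norm_num)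
    · rw [if_neg hTN, if_neg (by omega)]
      exact isSearch_firstSome_nil.mono (by positivity) le_rfl
  have hexact : ∀ i ∈ List.range (min T N), IsSearch B t vis k (exactSearch t k N (i + 1))
      (12 * Real.sqrt (N / (i + 1 : ℕ))) (if M = i + 1 then 0 else 1) := by
    intro i hi
    rw [List.mem_range, lt_min_iff] at hi
    exact isSearch_exactSearch hV (by omega) (by omega)
  refine (IsSearch.firstSome_map_append _ hexact
    (fun i _ => by split_ifs <;> norm_num) hrest).mono ?_ ?_
  · have hsum : ((List.range (min T N)).map fun i : ℕ => 12 * Real.sqrt (N / (i + 1 : ℕ))).sum =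
        ∑ i ∈ Finset.range (min T N), 12 * Real.sqrt (N / (i + 1 : ℕ)) := rfl
    have h1 := sum_sqrt_div_le N (min T N)
    have h2 : Real.sqrt (N * (min T N : ℕ)) ≤ Real.sqrt (N * T) := by
      gcongr
      exact min_le_left _ _
    rw [hsum, ← Finset.mul_sum]
    linarith
  · have he1 : e⁻¹ ≤ 1 := inv_le_one_of_one_le₀ (by linarith)
    have hle1 : ∀ l : List ℕ, (l.map fun i => if M = i + 1 then (0 : ℝ) else 1).prod ≤ 1 := by
      intro l
      induction l with
      | nil => simp
      | cons i l ih =>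
        rw [List.map_cons, List.prod_cons]
        split_ifs <;> simp [ih]
    by_cases hM0 : 0 < M
    · rw [if_pos hM0]
      by_cases hTM : T < M
      · rw [if_pos hTM]
        exact mul_le_of_le_one_left (by positivity) (hle1 _)
      · rw [List.prod_eq_zero, zero_mul]
        · positivity
        -- The exact searches are numbered from zero, so the one for `M` solutions has number `M -
        -- 1`.
        · refine List.mem_map.2 ⟨M - 1, ?_, ?_⟩
          · rw [List.mem_range, lt_min_iff]
            omega
          · rw [if_pos (by omega)]
    · rw [if_neg hM0, if_neg (by omega), mul_one]
      exact hle1 _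

theorem IsSearch.size {P : ℕ → Prog V A (Option (Fin V))} {c p : ℝ}
    (h : IsSearch B t vis k (P (B.size k)) c p) : IsSearch B t vis k (.size k P) (c + 1) p where
  cost_nonneg := add_nonneg h.cost_nonneg zero_le_one
  fail_nonneg := h.fail_nonneg
  sound s hs := h.sound s.tick hs
  time s hs := by
    refine (h.time s.tick hs).trans ?_
    rw [ENNReal.ofReal_add h.cost_nonneg zero_le_one]
    simp only [Machine.tick]
    push_cast
    rw [ENNReal.ofReal_one, add_right_comm, ← add_assoc]
  fail s hs := h.fail s.tick hs

/-- An upper bound for the expected running time of *findsol*, with `N` the size of the domain, `T` the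
number of rounds of BCWZ and `M` the number of solutions. -/
def findsolCost (N T : ℝ) (M : ℕ) : ℝ :=
  -- 409 = 2 · 176 + 57, with one unit for `size`; 353 = 2 · 176 + 1, that unit being absorbed by
  -- √(N/M) ≥ 1. The divisor M² is the effect of two runs of BBHT.
  if M = 0 then 409 * Real.sqrt (N * T) + 1
  else 353 * Real.sqrt (N / M) + 57 * Real.sqrt (N * T) / M ^ 2

theorem isSearch_findsol (hV : B.size k ≤ V) {e : ℝ} (he : 2 ≤ e) :
    IsSearch B t vis k (findsol t e k)
      (findsolCost (B.size k) (bcwzRounds e) (solutions B t vis k).card)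
      (if 0 < (solutions B t vis k).card then e⁻¹ else 1) := by
  have hT1 : 1 ≤ bcwzRounds e := Nat.ceil_pos.2 (Real.logb_pos (by norm_num) (by linarith))
  have hbcwz := (isSearch_bcwz (t := t) (vis := vis) hV he).firstSome_cons isSearch_firstSome_nil
  by_cases hM : 0 < (solutions B t vis k).card
  · have h := isSearch_bbht hV hM
    refine (IsSearch.size (h.firstSome_cons (h.firstSome_cons hbcwz))).mono ?_ ?_
    · have hone := one_le_sqrt_size_div hV hM
      set M := (solutions B t vis k).card
      have hM1 : (M : ℝ)⁻¹ ≤ 1 := inv_le_one_of_one_le₀ (by exact_mod_cast hM)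
      rw [findsolCost, if_neg hM.ne', mul_zero, add_zero, div_eq_mul_inv (57 * _), ← inv_pow]
      have : (M : ℝ)⁻¹ * (176 * Real.sqrt (B.size k / M)) ≤ 176 * Real.sqrt (B.size k / M) :=
        mul_le_of_le_one_left (by positivity) hM1
      linarith
    · have hM1 : ((solutions B t vis k).card : ℝ)⁻¹ ≤ 1 :=
        inv_le_one_of_one_le₀ (by exact_mod_cast hM)
      have he0 : 0 ≤ e⁻¹ := by positivity
      rw [if_pos hM, mul_one]
      exact mul_le_of_le_one_left (by positivity) hM1 |>.trans' <|
        mul_le_mul_of_nonneg_left (mul_le_of_le_one_left he0 hM1) (by positivity)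
  · have h := isSearch_bbht_worst (t := t) (vis := vis) hV
    refine (IsSearch.size (h.firstSome_cons (h.firstSome_cons hbcwz))).mono ?_ ?_
    · rw [findsolCost, if_pos (Nat.eq_zero_of_not_pos hM)]
      have : Real.sqrt (B.size k) ≤ Real.sqrt (B.size k * bcwzRounds e) := by
        gcongr
        exact le_mul_of_one_le_right (by positivity) (by exact_mod_cast hT1)
      linarith
    · simp [hM]

end Search

/-! ### Depth-first search orders -/

section Order

variable {V : ℕ} (G : Digraph (Fin V))

/-- All neighbours of the vertex `x` are in the list `l`. -/
def Exhausted (l : List (Fin V)) (x : Fin V) : Prop := ∀ y, G.Adj x y → y ∈ l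

/-- `w` is a neighbour of the last member of `pre` which has neighbours outside `pre`. -/
def IsStep (pre : List (Fin V)) (w : Fin V) : Prop :=
  ∃ (older : List (Fin V)) (u : Fin V) (newer : List (Fin V)), pre = older ++ u :: newer ∧
    G.Adj u w ∧ ∀ x ∈ newer, Exhausted G pre x

/-- The vertex `k`, visited after the vertices of `p`, is the one from which a depth-first search that
has visited `l` continues. -/
def IsActive (p : List (Fin V)) (k : Fin V) (l : List (Fin V)) : Prop :=
  ∃ newer, l = p ++ k :: newer ∧ ∀ x ∈ newer, Exhausted G l x

/-- `l'` is obtained from `l` by completing the exploration of `k`, visited after the vertices of `p`. -/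
structure Explores (p : List (Fin V)) (k : Fin V) (l l' : List (Fin V)) : Prop where
  isPrefix : l <+: l'
  step : ∀ pre w, pre ++ [w] <+: l' → l.length ≤ pre.length → IsStep G pre w
  done : ∃ newer, l' = p ++ k :: newer ∧ ∀ x ∈ k :: newer, Exhausted G l' x

variable {G} {p : List (Fin V)} {k i : Fin V} {l l₂ l₃ : List (Fin V)}

theorem Exhausted.mono {x : Fin V} (h : Exhausted G l x) (hl : l <+: l₂) : Exhausted G l₂ x :=
  fun y hy => hl.subset (h y hy)

theorem IsActive.explores (h : IsActive G p k l) (hk : Exhausted G l k) : Explores G p k l l where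
  isPrefix := List.prefix_rfl
  step pre w h1 h2 := by
    have := h1.length_le
    simp only [List.length_append, List.length_singleton] at this
    omega
  done := by
    obtain ⟨newer, h1, h2⟩ := h
    exact ⟨newer, h1, by simpa using ⟨hk, h2⟩⟩

theorem isActive_append_singleton : IsActive G l i (l ++ [i]) := ⟨[], rfl, by simp⟩

/-- The completed subtree of `i` consists of exhausted vertices, so it joins the exhausted part
behind `k`. -/
theorem IsActive.of_explores (h : IsActive G p k l) (hi : Explores G l i (l ++ [i]) l₂) :
    IsActive G p k l₂ := by
  obtain ⟨newer, h1, h2⟩ := h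
  obtain ⟨newer', h3, h4⟩ := hi.done
  refine ⟨newer ++ i :: newer', by rw [h3, h1]; simp, fun x hx => ?_⟩
  rcases List.mem_append.1 hx with hx | hx
  · exact (h2 x hx).mono ((List.prefix_append _ _).trans hi.isPrefix)
  · exact h4 x hx

/-- A new vertex is `i` itself, or it lies in the subtree of `i`, or it is found after the return to
`k`. -/
theorem Explores.trans (h : IsActive G p k l) (hki : G.Adj k i)
    (hi : Explores G l i (l ++ [i]) l₂) (hk : Explores G p k l₂ l₃) : Explores G p k l l₃ where
  isPrefix := ((List.prefix_append _ _).trans hi.isPrefix).trans hk.isPrefix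
  step pre w h1 h2 := by
    rcases lt_or_ge pre.length l₂.length with h3 | h3
    · have h4 : pre ++ [w] <+: l₂ :=
        List.prefix_of_prefix_length_le h1 hk.isPrefix (by simpa using h3)
      rcases eq_or_lt_of_le h2 with h5 | h5
      · have h6 : pre ++ [w] <+: l ++ [i] :=
          List.prefix_of_prefix_length_le h4 hi.isPrefix (by simp [h5])
        have h7 := h6.eq_of_length (by simp [h5])
        -- The first new vertex is `i`, discovered from `k`; everything visited after `k` is
        -- exhausted by activity of `k`.
        obtain ⟨rfl, h8⟩ := List.append_inj' h7 rfl
        obtain rfl : w = i := by simpa using h8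
        obtain ⟨newer, h9, h10⟩ := h
        exact ⟨p, k, newer, h9, hki, h10⟩
      · exact hi.step pre w h4 (by simpa using h5)
    · exact hk.step pre w h1 h3
  done := hk.done

theorem Explores.isDFSOrder {a : Fin V} (h : Explores G [] a [a] l) (hl : l.Nodup) :
    IsDFSOrder G a l := by
  obtain ⟨newer, h1, h2⟩ := h.done
  refine ⟨by simp [h1], hl, ?_, ?_⟩
  · intro pre w suf h3 h4
    exact h.step pre w ⟨suf, by simp [h3]⟩ (List.length_pos_iff.2 h4)
  · intro v hv
    exact h2 v (by simpa [h1] using hv)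

end Order

/-! ### The depth-first search program -/

/-- The indices that can be asked about a vertex, with the answers of the black box, exhibit
exactly the neighbours of the vertex. -/
structure Represents {V : ℕ} {A : Type} (B : BlackBox V A) (t : Fin V → A → Option (Fin V))
    (G : Digraph (Fin V)) : Prop where
  size_le : ∀ k, B.size k ≤ V
  adj_iff : ∀ k v, G.Adj k v ↔ ∃ j : Fin V, j.val < B.size k ∧ t j (B.query k j) = some v

/-- The number of vertices which are not marked. -/
def numUnvisited {V : ℕ} (vis : Fin V → Bool) : ℕ := (Finset.univ.filter fun v => vis v = false).card

/-! ### How marking vertices changes the counts -/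

section Counting

variable {V : ℕ} {A : Type} {B : BlackBox V A} {t : Fin V → A → Option (Fin V)} {k : Fin V}

theorem mem_solutions {vis : Fin V → Bool} {j : Fin V} : j ∈ solutions B t vis k ↔
    j.val < B.size k ∧ ∃ v, t j (B.query k j) = some v ∧ vis v = false := by
  rw [solutions, Finset.mem_filter, unvisited]
  cases t j (B.query k j) <;> simp

/-- The index which exhibited the discovered vertex is no longer a solution; this strict decrease
drives the amortisation. -/
theorem solutions_card_lt {vis vis' : Fin V → Bool} (h : ∀ v, vis v = true → vis' v = true)
    {j v : Fin V} (hj : j.val < B.size k) (hv : t j (B.query k j) = some v) (h1 : vis v = false)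
    (h2 : vis' v = true) : (solutions B t vis' k).card < (solutions B t vis k).card := by
  refine Finset.card_lt_card ((Finset.ssubset_iff_of_subset fun i hi => ?_).2 ⟨j, ?_, ?_⟩)
  · obtain ⟨h3, w, h4, h5⟩ := mem_solutions.1 hi
    refine mem_solutions.2 ⟨h3, w, h4, ?_⟩
    by_contra h6
    simp [h w (by simpa using h6)] at h5
  · exact mem_solutions.2 ⟨hj, v, hv, h1⟩
  · rw [mem_solutions]
    rintro ⟨-, w, h4, h5⟩
    rw [hv] at h4
    obtain rfl := Option.some.inj h4
    simp [h2] at h5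

theorem numUnvisited_mono {vis vis' : Fin V → Bool} (h : ∀ v, vis v = true → vis' v = true) :
    numUnvisited vis' ≤ numUnvisited vis := by
  refine Finset.card_le_card fun v hv => ?_
  simp only [Finset.mem_filter, Finset.mem_univ, true_and] at hv ⊢
  by_contra h1
  simp [h v (by simpa using h1)] at hv

theorem numUnvisited_update {vis : Fin V → Bool} {i : Fin V} (hi : vis i = false) :
    numUnvisited (Function.update vis i true) + 1 = numUnvisited vis := by
  have : Finset.univ.filter (fun v => Function.update vis i true v = false) =
      (Finset.univ.filter fun v => vis v = false).erase i := by
    ext v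
    by_cases h : v = i <;> simp [h]
  rw [numUnvisited, this, Finset.card_erase_add_one (by simpa using hi), numUnvisited]

theorem le_update {vis : Fin V → Bool} {i : Fin V} (v : Fin V) (h : vis v = true) :
    Function.update vis i true v = true := by
  by_cases hv : v = i
  · simp [hv]
  · simpa [hv] using h

end Counting

section Configurations

variable {V : ℕ} {A : Type} [Fintype A]

/-- The configuration after a vertex has been visited and marked. -/
def Machine.discover (s : Machine V A) (i : Fin V) : Machine V A :=
  { vis := Function.update s.vis i true, out := s.out ++ [i], time := s.time + 2, reg := s.reg }

/-- The array `vis` marks the vertices visited so far, and none has been visited twice. -/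
def Machine.Consistent (s : Machine V A) : Prop :=
  s.out.Nodup ∧ ∀ v, s.vis v = true ↔ v ∈ s.out

theorem Machine.Consistent.discover {s : Machine V A} (h : s.Consistent) {i : Fin V}
    (hi : s.vis i = false) : (s.discover i).Consistent := by
  obtain ⟨h1, h2⟩ := h
  refine ⟨?_, fun v => ?_⟩
  · have : i ∉ s.out := fun hm => by simp [(h2 i).2 hm] at hi
    simp only [Machine.discover]
    rw [List.nodup_append]
    exact ⟨h1, by simp, by rintro x hx y hy rfl; simp_all⟩
  · by_cases hv : v = i <;> simp [Machine.discover, hv, h2]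

end Configurations

/-! ### Potentials paying for the searches -/

section Potential

variable {V : ℕ} {A : Type} {B : BlackBox V A}

/-- A potential `φ` with weight `μ` per vertex, which pays for the searches at a vertex `k` with `M`
unvisited neighbours. -/
structure IsPotential (B : BlackBox V A) (T : ℝ) (φ : Fin V → ℕ → ℝ) (μ : ℝ) : Prop where
  nonneg : ∀ k M, 0 ≤ φ k M
  mono : ∀ k, Monotone (φ k)
  weight_nonneg : 0 ≤ μ
  cost_le : ∀ k M, M ≤ B.size k → findsolCost (B.size k) T M ≤ 1 + φ k M
  -- The 3 consists of the two instructions `visit` and `write` and the additive 1 in the time bound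
  -- of the recursive call.
  cost_succ_le : ∀ k M, M + 1 ≤ B.size k →
    findsolCost (B.size k) T (M + 1) + 3 + φ k M ≤ φ k (M + 1) + μ

/-- The weight of the vertices which are not marked. -/
def unvisitedWeight (B : BlackBox V A) (φ : Fin V → ℕ → ℝ) (μ : ℝ) (vis : Fin V → Bool) : ℝ :=
  ∑ v, if vis v then 0 else μ + φ v (B.size v)

theorem unvisitedWeight_update {φ : Fin V → ℕ → ℝ} {μ : ℝ} {vis : Fin V → Bool} {i : Fin V}
    (hi : vis i = false) : unvisitedWeight B φ μ (Function.update vis i true) +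
      (μ + φ i (B.size i)) = unvisitedWeight B φ μ vis := by
  unfold unvisitedWeight
  rw [← Finset.add_sum_erase _ _ (Finset.mem_univ i),
    ← Finset.add_sum_erase Finset.univ (fun v => if vis v then 0 else μ + φ v (B.size v))
      (Finset.mem_univ i)]
  have : ∑ v ∈ Finset.univ.erase i, (if Function.update vis i true v then 0
      else μ + φ v (B.size v)) = ∑ v ∈ Finset.univ.erase i,
      if vis v then 0 else μ + φ v (B.size v) :=
    Finset.sum_congr rfl fun v hv => by simp [(Finset.mem_erase.1 hv).1]
  rw [this]
  simp [hi]

theorem IsPotential.unvisitedWeight_nonneg {T μ : ℝ} {φ : Fin V → ℕ → ℝ} (hφ : IsPotential B T φ μ)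
    (vis : Fin V → Bool) : 0 ≤ unvisitedWeight B φ μ vis := by
  refine Finset.sum_nonneg fun v _ => ?_
  split_ifs
  · exact le_rfl
  · exact add_nonneg hφ.weight_nonneg (hφ.nonneg _ _)

end Potential

section DFS

variable {V : ℕ} {A : Type} [Fintype A] [NeZero V] [AddCommGroup A] {B : BlackBox V A}
  {t : Fin V → A → Option (Fin V)} {G : Digraph (Fin V)} {e : ℝ}

theorem run_bodyLoop_succ (n : ℕ) (k : Fin V) (s : Machine V A) :
    run B (bodyLoop t e (n + 1) k) s = (run B (findsol t e k) s).bind fun x =>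
      match x.1 with
      | none => PMF.pure ((), x.2)
      | some i => (run B (bodyLoop t e n i) (x.2.discover i)).bind fun y =>
          run B (bodyLoop t e n k) y.2 := by
  have : bodyLoop t e (n + 1) k = (findsol t e k).bind' fun r => match r with
    | none => .ret ()
    | some i => .visit i (.write i true ((bodyLoop t e n i).bind' fun _ => bodyLoop t e n k)) := by
    rw [bodyLoop]
    refine congrArg (Prog.bind' _) (funext fun r => ?_)
    cases r <;> rfl
  rw [this, run_bind]
  congr 1
  funext x
  rcases x with ⟨_ | i, s'⟩
  · rfl
  · simp only [run, run_bind]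
    rfl

/-- These properties hold surely, even on runs where a search has missed a neighbour. -/
theorem vis_mono_of_mem_support (hR : Represents B t G) (he : 2 ≤ e) (n : ℕ) (k : Fin V)
    (s : Machine V A) : ∀ x ∈ (run B (bodyLoop t e n k) s).support,
      (∀ v, s.vis v = true → x.2.vis v = true) ∧ (s.Consistent → x.2.Consistent) := by
  induction n generalizing k s with
  | zero =>
    intro x hx
    simp only [bodyLoop, run, PMF.support_pure, Set.mem_singleton_iff] at hx
    subst hx
    exact ⟨fun _ h => h, fun h => h⟩
  | succ n ih =>
    intro x hx
    rw [run_bodyLoop_succ, PMF.mem_support_bind_iff] at hx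
    obtain ⟨⟨r, s'⟩, hy, hx⟩ := hx
    obtain ⟨h1, h2, h3⟩ := (isSearch_findsol (t := t) (hR.size_le k) he).sound s rfl _ hy
    have hc : s.Consistent → s'.Consistent := fun h => by
      dsimp only at h1 h2
      rwa [Machine.Consistent, h1, h2]
    cases r with
    | none =>
      simp only [PMF.support_pure, Set.mem_singleton_iff] at hx
      subst hx
      exact ⟨fun v hv => h1 ▸ hv, hc⟩
    | some i =>
      obtain ⟨y, hy', hx⟩ := (PMF.mem_support_bind_iff _ _ _).1 hx
      obtain ⟨-, -, -, hi⟩ := h3 i rfl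
      obtain ⟨h4, h5⟩ := ih i _ y hy'
      obtain ⟨h6, h7⟩ := ih k _ x hx
      refine ⟨fun v hv => h6 v (h4 v (le_update v (h1 ▸ hv))), fun h => h7 (h5 ?_)⟩
      exact (hc h).discover (h1 ▸ hi)

/-! ### Correctness -/

open Classical in
/-- One if the exploration of `k` has not been completed, and zero otherwise. -/
def incomplete (G : Digraph (Fin V)) (p : List (Fin V)) (k : Fin V) (l l' : List (Fin V)) : ℝ≥0∞ :=
  if Explores G p k l l' then 0 else 1

/-- With δ = 1/e, the call itself risks δ in its first search. Each newly marked vertex releases 2δ,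
which pays for the allowance δ of the recursive call at that vertex and of the continued loop at
`k`. The depth bound exceeds the number of unmarked vertices, so it is never exhausted. -/
theorem expect_incomplete_bodyLoop (hR : Represents B t G) (he : 2 ≤ e) (n : ℕ) (k : Fin V)
    (s : Machine V A) (p : List (Fin V)) (hs : s.Consistent) (hp : IsActive G p k s.out)
    (hn : numUnvisited s.vis < n) :
    (expect (run B (bodyLoop t e n k) s) fun x => incomplete G p k s.out x.2.out +
      ENNReal.ofReal e⁻¹ * (2 * numUnvisited x.2.vis : ℕ)) ≤
    ENNReal.ofReal e⁻¹ + ENNReal.ofReal e⁻¹ * (2 * numUnvisited s.vis : ℕ) := by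
  induction n generalizing k s p with
  | zero => omega
  | succ n ih =>
    set δ := ENNReal.ofReal e⁻¹
    have hf := isSearch_findsol (t := t) (vis := s.vis) (hR.size_le k) he
    have hone : ∀ l l', incomplete G p k l l' ≤ 1 := fun l l' => by
      unfold incomplete; split_ifs <;> simp
    rw [run_bodyLoop_succ, expect_bind]
    have key : ∀ x ∈ (run B (findsol t e k) s).support,
        expect (match x.1 with
          | none => PMF.pure ((), x.2)
          | some i => (run B (bodyLoop t e n i) (x.2.discover i)).bind fun y =>
              run B (bodyLoop t e n k) y.2)
          (fun x => incomplete G p k s.out x.2.out + δ * (2 * numUnvisited x.2.vis : ℕ)) ≤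
        (if 0 < (solutions B t s.vis k).card then noneInd x.1 else 0) +
          δ * (2 * numUnvisited s.vis : ℕ) := by
      rintro ⟨r, s'⟩ hx
      obtain ⟨h1, h2, h3⟩ := hf.sound s rfl _ hx
      dsimp only at h1 h2 h3
      cases r with
      | none =>
        simp only [expect_pure, h1, h2, noneInd]
        gcongr
        split_ifs with hM
        · exact hone _ _
        · have hk : Exhausted G s.out k := by
            intro y hy
            obtain ⟨j, hj, hjy⟩ := (hR.adj_iff k y).1 hy
            rw [← hs.2]
            by_contra hv
            exact hM (Finset.card_pos.2 ⟨j, mem_solutions.2 ⟨hj, y, hjy, by simpa using hv⟩⟩)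
          rw [incomplete, if_pos (hp.explores hk)]
      | some i =>
        obtain ⟨j, hj, hji, hi⟩ := h3 i rfl
        have hki : G.Adj k i := (hR.adj_iff k i).2 ⟨j, hj, hji⟩
        have hs' : s'.Consistent := by rwa [Machine.Consistent, h1, h2]
        have hcount : numUnvisited (s'.discover i).vis + 1 = numUnvisited s.vis := by
          rw [Machine.discover, h1]
          exact numUnvisited_update hi
        have hout : (s'.discover i).out = s.out ++ [i] := by rw [Machine.discover, h2]
        have hd : (s'.discover i).Consistent := hs'.discover (h1 ▸ hi)
        dsimp only
        rw [expect_bind]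
        calc _ ≤ expect (run B (bodyLoop t e n i) (s'.discover i)) fun y =>
              (incomplete G s.out i (s.out ++ [i]) y.2.out +
                δ * (2 * numUnvisited y.2.vis : ℕ)) + δ := by
              refine expect_mono_support fun y hy => ?_
              obtain ⟨h4, h5⟩ := vis_mono_of_mem_support hR he n i _ y hy
              -- If the exploration of `i` is complete, induction applies at `k`, which is still
              -- active. If not, the indicator for `i` is already one and covers any failure at `k`.
              by_cases hE : Explores G s.out i (s.out ++ [i]) y.2.out
              · have hlt : numUnvisited y.2.vis < n :=
                  (numUnvisited_mono h4).trans_lt (by omega)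
                rw [incomplete, if_pos hE, zero_add, add_comm _ δ]
                refine (expect_mono fun x => ?_).trans (ih k y.2 p (h5 hd) (hp.of_explores hE) hlt)
                gcongr
                unfold incomplete
                by_cases h7 : Explores G p k y.2.out x.2.out
                · simp [h7, Explores.trans hp hki hE h7]
                · rw [if_neg h7]
                  split_ifs <;> simp
              · rw [incomplete, if_neg hE]
                refine le_trans (expect_mono_support fun x hx => ?_)
                  ((expect_const _ _).trans_le le_self_add)
                have := numUnvisited_mono (vis_mono_of_mem_support hR he n k _ x hx).1
                gcongr
                exact hone _ _
          _ ≤ δ + δ * (2 * numUnvisited (s'.discover i).vis : ℕ) + δ := by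
              rw [expect_add, expect_const]
              gcongr
              have := ih i (s'.discover i) s.out hd (hout ▸ isActive_append_singleton) (by omega)
              rwa [hout] at this
          _ = δ * (2 * numUnvisited s.vis : ℕ) := by
              rw [← hcount]
              push_cast
              ring
          _ ≤ _ := le_add_self
    refine (expect_mono_support key).trans ?_
    rw [expect_add, expect_const]
    gcongr
    by_cases hM : 0 < (solutions B t s.vis k).card
    · simpa [hM] using hf.fail s rfl
    · simp [hM, expect_const]

/-! ### Running time -/

/-- Amortised analysis: discovering `i` releases `μ + φ i (B.size i)`, where `φ` pays for the
searches at `i` and `μ` helps to pay for the search that found it. Exhausting the depth bound only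
saves time, so no condition relates `n` to the unmarked vertices. -/
theorem expect_time_bodyLoop (hR : Represents B t G) (he : 2 ≤ e) {φ : Fin V → ℕ → ℝ} {μ : ℝ}
    (hφ : IsPotential B (bcwzRounds e) φ μ) (n : ℕ) (k : Fin V) (s : Machine V A) :
    (expect (run B (bodyLoop t e n k) s) fun x =>
      (x.2.time : ℝ≥0∞) + ENNReal.ofReal (unvisitedWeight B φ μ x.2.vis)) ≤
    s.time + ENNReal.ofReal
      (1 + φ k (solutions B t s.vis k).card + unvisitedWeight B φ μ s.vis) := by
  induction n generalizing k s with
  | zero =>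
    simp only [bodyLoop, run, expect_pure]
    gcongr
    linarith [hφ.nonneg k (solutions B t s.vis k).card]
  | succ n ih =>
    have hf := isSearch_findsol (t := t) (vis := s.vis) (hR.size_le k) he
    have hU := hφ.unvisitedWeight_nonneg s.vis
    have hMN := card_solutions_le (t := t) (vis := s.vis) (hR.size_le k)
    set M := (solutions B t s.vis k).card with hM
    set c := findsolCost (B.size k) (bcwzRounds e) M
    have hc := hφ.cost_le k M hMN
    have hc0 := hf.cost_nonneg
    rw [run_bodyLoop_succ, expect_bind]
    have key : ∀ x ∈ (run B (findsol t e k) s).support,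
        expect (match x.1 with
          | none => PMF.pure ((), x.2)
          | some i => (run B (bodyLoop t e n i) (x.2.discover i)).bind fun y =>
              run B (bodyLoop t e n k) y.2)
          (fun x => (x.2.time : ℝ≥0∞) + ENNReal.ofReal (unvisitedWeight B φ μ x.2.vis)) ≤
        x.2.time + ENNReal.ofReal (1 + φ k M - c + unvisitedWeight B φ μ s.vis) := by
      rintro ⟨r, s'⟩ hx
      obtain ⟨h1, -, h3⟩ := hf.sound s rfl _ hx
      dsimp only at h1 h3
      cases r with
      | none =>
        simp only [expect_pure, h1]
        gcongr
        linarith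
      | some i =>
        obtain ⟨j, hj, hji, hi⟩ := h3 i rfl
        have hM0 : 0 < M := Finset.card_pos.2 ⟨j, mem_solutions.2 ⟨hj, i, hji, hi⟩⟩
        obtain ⟨m, hm⟩ : ∃ m, M = m + 1 := ⟨M - 1, by omega⟩
        have hvis : (s'.discover i).vis = Function.update s.vis i true := by
          rw [Machine.discover, h1]
        have hw := unvisitedWeight_update (B := B) (φ := φ) (μ := μ) hi
        have hU' := hφ.unvisitedWeight_nonneg (Function.update s.vis i true)
        have hφm := hφ.nonneg k m
        have hφi := hφ.nonneg i (B.size i)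
        have hstep := hφ.cost_succ_le k m (by omega)
        rw [← hm] at hstep
        dsimp only
        rw [expect_bind]
        calc _ ≤ expect (run B (bodyLoop t e n i) (s'.discover i)) fun y =>
              ((y.2.time : ℝ≥0∞) + ENNReal.ofReal (unvisitedWeight B φ μ y.2.vis)) +
                ENNReal.ofReal (1 + φ k m) := by
              refine expect_mono_support fun y hy => (ih k y.2).trans ?_
              obtain ⟨h4, -⟩ := vis_mono_of_mem_support hR he n i _ y hy
              -- The subtree of `i` may have marked further neighbours of `k`, so the count can drop
              -- by more than one; monotonicity of `φ k` absorbs this.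
              have hlt : (solutions B t y.2.vis k).card < M :=
                solutions_card_lt (fun v hv => h4 v (hvis ▸ le_update v hv)) hj hji hi
                  (h4 i (by simp [hvis]))
              have hle := hφ.mono k (show (solutions B t y.2.vis k).card ≤ m by omega)
              rw [add_assoc (y.2.time : ℝ≥0∞),
                ← ENNReal.ofReal_add (hφ.unvisitedWeight_nonneg _) (by linarith)]
              exact add_le_add le_rfl (ENNReal.ofReal_le_ofReal (by linarith))
          _ ≤ (s'.time + 2 : ℕ) + ENNReal.ofReal
                (1 + φ i (B.size i) + unvisitedWeight B φ μ (Function.update s.vis i true)) +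
                ENNReal.ofReal (1 + φ k m) := by
              rw [expect_add, expect_const]
              gcongr
              refine (ih i (s'.discover i)).trans ?_
              rw [hvis]
              have := hφ.mono i (card_solutions_le (t := t)
                (vis := Function.update s.vis i true) (hR.size_le i))
              have ht : (s'.discover i).time = s'.time + 2 := rfl
              rw [ht]
              gcongr
          _ = s'.time + ENNReal.ofReal (2 + (1 + φ i (B.size i) +
                unvisitedWeight B φ μ (Function.update s.vis i true)) + (1 + φ k m)) := by
              have h2 : ((s'.time + 2 : ℕ) : ℝ≥0∞) = s'.time + ENNReal.ofReal 2 := by simp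
              rw [h2, add_assoc (s'.time : ℝ≥0∞), add_assoc (s'.time : ℝ≥0∞),
                ← ENNReal.ofReal_add (by norm_num) (by linarith),
                ← ENNReal.ofReal_add (by linarith) (by linarith)]
          _ ≤ _ := add_le_add le_rfl (ENNReal.ofReal_le_ofReal (by linarith))
    refine (expect_mono_support key).trans ?_
    rw [expect_add, expect_const]
    calc _ ≤ s.time + ENNReal.ofReal c +
          ENNReal.ofReal (1 + φ k M - c + unvisitedWeight B φ μ s.vis) := by
          gcongr
          exact hf.time s rfl
      _ = _ := by
          rw [add_assoc, ← ENNReal.ofReal_add hc0 (by linarith)]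
          congr 2
          ring

end DFS

/-! ### A potential for the running time -/

/-- The potential of a vertex with a domain of size `N` and `M` unvisited neighbours. -/
def dfsPotential (l T : ℝ) (N M : ℕ) : ℝ :=
  -- The first term, constant once `M ≥ l² N`, pays for √(N/M). The factor `3 - 2 / (M + 1)` is 1 at
  -- `M = 0`, for the final search, and the step from `M` to `M + 1` raises it by at least 1/(M+1)²,
  -- for the BCWZ part; it stays below 3.
  409 * (2 * Real.sqrt (N * min (M : ℝ) (l ^ 2 * N)) +
    Real.sqrt (N * T) * (3 - 2 / (M + 1 : ℕ)))

theorem dfsPotential_mono {l T : ℝ} (N : ℕ) : Monotone (dfsPotential l T N) := by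
  intro M M' h
  unfold dfsPotential
  gcongr

theorem dfsPotential_nonneg {l T : ℝ} (N M : ℕ) : 0 ≤ dfsPotential l T N M := by
  have h : (2 : ℝ) / (M + 1 : ℕ) ≤ 2 :=
    div_le_self (by norm_num) (by exact_mod_cast Nat.succ_le_succ (Nat.zero_le M))
  have : 0 ≤ 3 - (2 : ℝ) / (M + 1 : ℕ) := by linarith
  unfold dfsPotential
  positivity

theorem dfsPotential_le {l T : ℝ} (hl : 0 < l) (N : ℕ) :
    dfsPotential l T N N ≤ 409 * (2 * (l * N) + 3 * Real.sqrt (N * T)) := by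
  have h1 : Real.sqrt (N * min (N : ℝ) (l ^ 2 * N)) ≤ l * N := by
    refine Real.sqrt_le_iff.2 ⟨by positivity, ?_⟩
    calc (N : ℝ) * min (N : ℝ) (l ^ 2 * N) ≤ N * (l ^ 2 * N) := by
          gcongr
          exact min_le_right _ _
      _ = _ := by ring
  have h2 : Real.sqrt (N * T) * (3 - 2 / (N + 1 : ℕ)) ≤ Real.sqrt (N * T) * 3 := by
    gcongr
    linarith [show (0 : ℝ) ≤ 2 / (N + 1 : ℕ) by positivity]
  unfold dfsPotential
  linarith

/-- For `M + 1 ≤ l² N` this is the telescoping bound; otherwise the left side is itself at most 1/l,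
the share charged to the discovered vertex. -/
theorem sqrt_div_le_min {l : ℝ} (hl : 0 < l) {N M : ℕ} (hN : 0 < N) :
    Real.sqrt (N / (M + 1 : ℕ)) ≤ 2 * Real.sqrt (N * min ((M + 1 : ℕ) : ℝ) (l ^ 2 * N)) -
      2 * Real.sqrt (N * min (M : ℝ) (l ^ 2 * N)) + l⁻¹ := by
  have hN' : (0 : ℝ) < N := by exact_mod_cast hN
  have hl' : 0 < l⁻¹ := inv_pos.2 hl
  rcases le_or_gt ((M + 1 : ℕ) : ℝ) (l ^ 2 * N) with h | h
  · rw [min_eq_left h, min_eq_left (by push_cast at h; linarith)]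
    linarith [sqrt_div_le N M]
  · have h1 : Real.sqrt (N / (M + 1 : ℕ)) ≤ l⁻¹ := by
      refine Real.sqrt_le_iff.2 ⟨hl'.le, ?_⟩
      rw [inv_pow, div_le_iff₀ (by positivity), inv_mul_eq_div, le_div_iff₀ (by positivity)]
      linarith
    have h2 : Real.sqrt (N * min (M : ℝ) (l ^ 2 * N)) ≤
        Real.sqrt (N * min ((M + 1 : ℕ) : ℝ) (l ^ 2 * N)) := by
      gcongr
      exact Nat.le_succ M
    linarith

section Bounds

variable {V : ℕ} {A : Type} {B : BlackBox V A}

theorem isPotential_dfsPotential {l T : ℝ} (hl : 0 < l) (hT : 1 ≤ T) :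
    IsPotential B T (fun k => dfsPotential l T (B.size k)) (409 * l⁻¹) where
  nonneg k M := dfsPotential_nonneg _ _
  mono k := dfsPotential_mono _
  weight_nonneg := by positivity
  cost_le k M hM := by
    have hs : 0 ≤ Real.sqrt (B.size k * min (M : ℝ) (l ^ 2 * B.size k)) := Real.sqrt_nonneg _
    rcases Nat.eq_zero_or_pos M with rfl | hM0
    · have h1 : (2 : ℝ) / (0 + 1 : ℕ) = 2 := by norm_num
      rw [findsolCost, if_pos rfl, dfsPotential, h1]
      linarith
    · have hM1 : (1 : ℝ) ≤ M := by exact_mod_cast hM0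
      have h1 : Real.sqrt (B.size k / M) ≤ Real.sqrt (B.size k * T) := by
        gcongr
        calc (B.size k : ℝ) / M ≤ B.size k := div_le_self (by positivity) hM1
          _ ≤ _ := le_mul_of_one_le_right (by positivity) hT
      have h2 : 57 * Real.sqrt (B.size k * T) / (M : ℝ) ^ 2 ≤ 57 * Real.sqrt (B.size k * T) :=
        div_le_self (by positivity) (one_le_pow₀ hM1)
      have h3 : (2 : ℝ) / (M + 1 : ℕ) ≤ 1 := by
        rw [div_le_one (by positivity)]
        push_cast
        linarith
      have h4 : Real.sqrt (B.size k * T) * 2 ≤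
          Real.sqrt (B.size k * T) * (3 - 2 / (M + 1 : ℕ)) := by
        gcongr
        linarith
      rw [findsolCost, if_neg hM0.ne', dfsPotential]
      linarith [Real.sqrt_nonneg (B.size k * T)]
  cost_succ_le k M hM := by
    -- This absorbs the constant 3, and 353 + 3 ≤ 409.
    have hone : 1 ≤ Real.sqrt (B.size k / (M + 1 : ℕ)) := by
      rw [Real.one_le_sqrt, one_le_div (by positivity)]
      exact_mod_cast hM
    have h1 := sqrt_div_le_min hl (N := B.size k) (M := M) (by omega)
    have h2 : Real.sqrt (B.size k * T) * (1 / ((M + 1 : ℕ) : ℝ) ^ 2) ≤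
        Real.sqrt (B.size k * T) * (2 / (M + 1 : ℕ) - 2 / (M + 1 + 1 : ℕ)) := by
      gcongr
      rw [div_sub_div _ _ (by positivity) (by positivity),
        div_le_div_iff₀ (by positivity) (by positivity)]
      push_cast
      have : (0 : ℝ) ≤ M := by positivity
      nlinarith [pow_nonneg this 3, pow_nonneg this 2]
    have h3 : 0 ≤ Real.sqrt (B.size k * T) * (1 / ((M + 1 : ℕ) : ℝ) ^ 2) := by positivity
    rw [findsolCost, if_neg (Nat.succ_ne_zero M), dfsPotential, dfsPotential,
      mul_div_assoc, div_eq_mul_one_div (Real.sqrt (B.size k * T))]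
    linarith

end Bounds

/-! ### Failure probability and running time of DFS -/

/-- Cauchy–Schwarz over the `V` vertices. -/
theorem sum_sqrt_mul_le {V : ℕ} (f : Fin V → ℕ) {T : ℝ} (hT : 0 ≤ T) :
    ∑ k, Real.sqrt (f k * T) ≤ Real.sqrt (V * (∑ k, f k : ℕ) * T) := by
  refine Real.le_sqrt_of_sq_le ?_
  have := sq_sum_le_card_mul_sum_sq (s := Finset.univ) (f := fun k => Real.sqrt (f k * T))
  refine this.trans_eq ?_
  rw [Finset.card_univ, Fintype.card_fin, Finset.sum_congr rfl fun k _ =>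
    Real.sq_sqrt (show 0 ≤ (f k : ℝ) * T by positivity), ← Finset.sum_mul]
  push_cast
  ring

section Law

variable {V : ℕ} {A : Type} [Fintype A] [NeZero V] [AddCommGroup A] {B : BlackBox V A}
  {t : Fin V → A → Option (Fin V)} {G : Digraph (Fin V)}

/-- The configuration after the first vertex `a` has been visited and marked. -/
def initial (V : ℕ) (A : Type) [Fintype A] [NeZero V] [AddCommGroup A] (a : Fin V) : Machine V A :=
  Machine.discover { vis := fun _ => false, out := [], time := 0, reg := ket (0, 0, false, false) } a

theorem dfsLaw_eq (ε : ℝ) (a : Fin V) : dfsLaw B t ε a =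
    (run B (bodyLoop t (2 * V * ε⁻¹) V a) (initial V A a)).map fun x => (x.2.out, x.2.time) := rfl

theorem two_le_param {V : ℕ} [NeZero V] {ε : ℝ} (h0 : 0 < ε) (h1 : ε ≤ 1) : 2 ≤ 2 * V * ε⁻¹ := by
  have hV : (1 : ℝ) ≤ V := by exact_mod_cast NeZero.one_le
  have := one_le_mul_of_one_le_of_one_le hV ((one_le_inv₀ h0).2 h1)
  linarith

theorem initial_consistent (a : Fin V) : (initial V A a).Consistent :=
  Machine.Consistent.discover (by simp [Machine.Consistent]) rfl

theorem numUnvisited_initial (a : Fin V) : numUnvisited (initial V A a).vis + 1 = V := by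
  rw [initial, Machine.discover, numUnvisited_update rfl, numUnvisited]
  simp

/-- At the root V - 1 vertices are unmarked, so the bound is δ + 2(V-1)δ ≤ 2Vδ = ε. -/
theorem failProb_dfsLaw_le (hR : Represents B t G) {ε : ℝ} (h0 : 0 < ε) (h1 : ε ≤ 1) (a : Fin V) :
    failProb G a (dfsLaw B t ε a) ≤ ENNReal.ofReal ε := by
  have he := two_le_param (V := V) h0 h1
  have hV : (0 : ℝ) < V := by exact_mod_cast NeZero.pos V
  have hn := numUnvisited_initial (A := A) a
  have h := expect_incomplete_bodyLoop hR he V a (initial V A a) [] (initial_consistent a)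
    isActive_append_singleton (by omega)
  classical
  have hfail : failProb G a (dfsLaw B t ε a) =
      expect (dfsLaw B t ε a) fun x => if IsDFSOrder G a x.1 then 0 else 1 := by
    rw [failProb, PMF.toOuterMeasure_apply, expect]
    refine tsum_congr fun x => ?_
    by_cases hx : IsDFSOrder G a x.1 <;> simp [hx]
  rw [hfail, dfsLaw_eq, expect_map]
  calc _ ≤ ENNReal.ofReal (2 * V * ε⁻¹)⁻¹ + ENNReal.ofReal (2 * V * ε⁻¹)⁻¹ *
        (2 * numUnvisited (initial V A a).vis : ℕ) := by
        refine (expect_mono_support fun x hx => ?_).trans h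
        refine le_add_right ?_
        have hc := (vis_mono_of_mem_support hR he V a _ x hx).2 (initial_consistent a)
        unfold incomplete
        by_cases hE : Explores G [] a (initial V A a).out x.2.out
        · have := Explores.isDFSOrder hE hc.1
          simp [this]
        · rw [if_neg hE]
          split_ifs <;> simp
    _ ≤ ENNReal.ofReal (2 * V * ε⁻¹)⁻¹ * (2 * V : ℕ) := by
        rw [← mul_one_add]
        gcongr
        norm_cast
        omega
    _ = ENNReal.ofReal ε := by
        rw [← ENNReal.ofReal_natCast, ← ENNReal.ofReal_mul (by positivity)]
        congr 1
        push_cast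
        field_simp

theorem expectedTime_dfsLaw_le_rounds (hR : Represents B t G) {ε : ℝ} (h0 : 0 < ε) (h1 : ε ≤ 1)
    (a : Fin V) (hD : 1 ≤ ∑ k, B.size k) :
    expectedTime (dfsLaw B t ε a) ≤ ENNReal.ofReal (2457 *
      Real.sqrt (V * (∑ k, B.size k : ℕ) * bcwzRounds (2 * V * ε⁻¹))) := by
  have he := two_le_param (V := V) h0 h1
  have hV : (1 : ℝ) ≤ V := by exact_mod_cast NeZero.one_le
  have hD' : (1 : ℝ) ≤ (∑ k, B.size k : ℕ) := by exact_mod_cast hD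
  have hT : (1 : ℝ) ≤ bcwzRounds (2 * V * ε⁻¹) := by
    have : 0 < bcwzRounds (2 * V * ε⁻¹) :=
      Nat.ceil_pos.2 (Real.logb_pos (by norm_num) (by linarith))
    exact_mod_cast this
  set T : ℝ := (bcwzRounds (2 * V * ε⁻¹) : ℝ) with hTdef
  set D : ℝ := ((∑ k, B.size k : ℕ) : ℝ) with hDdef
  -- This value balances `l * D` against `V / l`; both become √(VD).
  set l := Real.sqrt (V / D) with hl
  have hl0 : 0 < l := Real.sqrt_pos.2 (by positivity)
  have hpot := isPotential_dfsPotential (B := B) hl0 hT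
  have h := expect_time_bodyLoop hR he hpot V a (initial V A a)
  have hexp : expectedTime (dfsLaw B t ε a) =
      expect (dfsLaw B t ε a) fun x => (x.2 : ℝ≥0∞) := rfl
  rw [hexp, dfsLaw_eq, expect_map]
  refine (expect_mono fun x => le_self_add).trans (h.trans ?_)
  have htime : ((initial V A a).time : ℝ≥0∞) = ENNReal.ofReal 2 := by
    simp [initial, Machine.discover]
  have hU := hpot.unvisitedWeight_nonneg (initial V A a).vis
  have hφ := hpot.nonneg a (solutions B t (initial V A a).vis a).card
  rw [htime, ← ENNReal.ofReal_add (by norm_num) (by linarith)]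
  refine ENNReal.ofReal_le_ofReal ?_
  have hφa := hpot.mono a (card_solutions_le (t := t) (vis := (initial V A a).vis) (hR.size_le a))
  have hU1 := unvisitedWeight_update (B := B) (φ := fun k => dfsPotential l T (B.size k))
    (μ := 409 * l⁻¹) (vis := fun _ => false) (i := a) rfl
  have hU2 : unvisitedWeight B (fun k => dfsPotential l T (B.size k)) (409 * l⁻¹) (fun _ => false) ≤
      409 * (V * l⁻¹) + 409 * (2 * (l * D) + 3 * Real.sqrt (V * D * T)) := by
    have hsum := sum_sqrt_mul_le B.size (T := T) (by linarith)
    calc _ ≤ ∑ k : Fin V, (409 * l⁻¹ +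
          409 * (2 * (l * B.size k) + 3 * Real.sqrt (B.size k * T))) := by
          refine Finset.sum_le_sum fun k _ => ?_
          have := dfsPotential_le (T := T) hl0 (B.size k)
          simp only [Bool.false_eq_true, if_false]
          linarith
      _ = 409 * (V * l⁻¹) + 409 * (2 * (l * D) + 3 * ∑ k, Real.sqrt (B.size k * T)) := by
          simp only [hDdef, Nat.cast_sum, Finset.mul_sum, Finset.sum_add_distrib, Finset.sum_const,
            Finset.card_univ, Fintype.card_fin, nsmul_eq_mul, mul_add]
          ring
      _ ≤ _ := by linarith
  have hlD : l * D = Real.sqrt (V * D) := by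
    rw [hl, Real.sqrt_div' _ (by linarith), Real.sqrt_mul' _ (by linarith), div_mul_eq_mul_div,
      mul_div_assoc, Real.div_sqrt]
  have hlV : V * l⁻¹ = Real.sqrt (V * D) := by
    rw [hl, ← Real.sqrt_inv, inv_div, Real.sqrt_div' _ (by linarith),
      Real.sqrt_mul' _ (by linarith), ← mul_div_assoc, mul_comm (V : ℝ), mul_div_assoc,
      Real.div_sqrt, mul_comm]
  have hVD : 1 ≤ (V : ℝ) * D := one_le_mul_of_one_le_of_one_le hV hD'
  have h2 : Real.sqrt (V * D) ≤ Real.sqrt (V * D * T) := by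
    exact Real.sqrt_le_sqrt (le_mul_of_one_le_right (by linarith) hT)
  have h3 : 1 ≤ Real.sqrt (V * D) := Real.one_le_sqrt.2 hVD
  have hvis : (initial V A a).vis = Function.update (fun _ => false) a true := rfl
  have hl1 : 0 ≤ 409 * l⁻¹ := by positivity
  rw [← hvis] at hU1
  rw [hlD, hlV] at hU2
  -- 2457 = 3 + 409 · (1 + 2 + 3): two instructions at the root and the additive 1, then the charges
  -- `V / l`, `2 l D` and `3 √(V D T)`, everything being bounded by multiples of √(VDT).
  linarith

/-- ⌈1 + lg(V/ε)⌉ ≤ 2 + lg(V/ε), and lg(V/ε) ≥ 1 because `V ≥ 2`. -/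
theorem bcwzRounds_le {V : ℕ} {ε : ℝ} (hV : 2 ≤ V) (h0 : 0 < ε) (h1 : ε ≤ 1) :
    (bcwzRounds (2 * V * ε⁻¹) : ℝ) ≤ 3 * Real.logb 2 (V * ε⁻¹) := by
  have hV' : (2 : ℝ) ≤ V := by exact_mod_cast hV
  have h2 : 2 ≤ V * ε⁻¹ := by
    nlinarith [(one_le_inv₀ h0).2 h1]
  have h3 : 1 ≤ Real.logb 2 (V * ε⁻¹) := by
    rw [Real.le_logb_iff_rpow_le (by norm_num) (by linarith), Real.rpow_one]
    exact h2
  have h4 : Real.logb 2 (2 * V * ε⁻¹) = 1 + Real.logb 2 (V * ε⁻¹) := by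
    rw [mul_assoc, Real.logb_mul (by norm_num) (by linarith), Real.logb_self_eq_one (by norm_num)]
  have h5 := Nat.ceil_lt_add_one (show 0 ≤ Real.logb 2 (2 * V * ε⁻¹) by linarith)
  rw [bcwzRounds]
  linarith

/-- The slack `2 * D` covers undirected graphs, whose edges are listed twice. With the factor 3 of
`bcwzRounds_le` the radicand grows by at most 6 ≤ 3², and 7371 = 3 · 2457. -/
theorem expectedTime_dfsLaw_le (hR : Represents B t G) {ε : ℝ} (hV : 2 ≤ V) (h0 : 0 < ε)
    (h1 : ε ≤ 1) (a : Fin V) (hD : 1 ≤ ∑ k, B.size k) {D : ℝ} (hD2 : (∑ k, B.size k : ℕ) ≤ 2 * D) :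
    expectedTime (dfsLaw B t ε a) ≤
      ENNReal.ofReal (7371 * Real.sqrt (V * D * Real.logb 2 (V * ε⁻¹))) := by
  refine (expectedTime_dfsLaw_le_rounds hR h0 h1 a hD).trans (ENNReal.ofReal_le_ofReal ?_)
  have hT := bcwzRounds_le hV h0 h1
  have hT0 : (0 : ℝ) ≤ bcwzRounds (2 * V * ε⁻¹) := by positivity
  have hD0 : 0 ≤ D := by
    have : (0 : ℝ) ≤ (∑ k, B.size k : ℕ) := by positivity
    linarith
  have : Real.sqrt (V * (∑ k, B.size k : ℕ) * bcwzRounds (2 * V * ε⁻¹)) ≤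
      Real.sqrt (3 ^ 2 * (V * D * Real.logb 2 (V * ε⁻¹))) := by
    refine Real.sqrt_le_sqrt ?_
    calc _ ≤ (V : ℝ) * (2 * D) * (3 * Real.logb 2 (V * ε⁻¹)) := by gcongr
      _ ≤ _ := by
        have : 0 ≤ V * D * Real.logb 2 (V * ε⁻¹) := by
          have : 0 ≤ Real.logb 2 (V * ε⁻¹) := by linarith
          positivity
        linarith
  rw [Real.sqrt_mul (show (0 : ℝ) ≤ 3 ^ 2 by norm_num), Real.sqrt_sq (by norm_num)] at this
  linarith

end Law

/-! ### The two models -/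

section Models

variable {V : ℕ} {G : Digraph (Fin V)}

theorem represents_matrixBox (G : Digraph (Fin V)) : Represents (matrixBox G) matrixTarget G where
  size_le _ := le_rfl
  adj_iff k v := by
    have : ∀ j, matrixTarget j ((matrixBox G).query k j) = some v ↔ j = v ∧ G.Adj k j := by
      intro j
      by_cases h : G.Adj k j <;> simp [matrixTarget, matrixBox, h]
    simp only [this]
    constructor
    · exact fun h => ⟨v, v.2, rfl, h⟩
    · rintro ⟨j, -, rfl, h⟩
      exact h

theorem length_dest_le (L : EdgeList G) (k : Fin V) : (L.dest k).length ≤ V := by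
  simpa using (L.nodup k).length_le_card

theorem represents_listBox [NeZero V] (L : EdgeList G) : Represents (listBox L) listTarget G where
  size_le := length_dest_le L
  adj_iff k v := by
    simp only [listTarget, listBox, Option.some.injEq]
    rw [← L.mem_iff, List.mem_iff_getElem]
    constructor
    · rintro ⟨j, hj, h⟩
      exact ⟨⟨j, hj.trans_le (length_dest_le L k)⟩, hj, by rw [List.getD_eq_getElem _ _ hj, h]⟩
    · rintro ⟨j, hj, h⟩
      exact ⟨j, hj, by rwa [List.getD_eq_getElem _ _ hj] at h⟩

theorem sum_length_dest (L : EdgeList G) :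
    ∑ k, (L.dest k).length = {p : Fin V × Fin V | G.Adj p.1 p.2}.ncard := by
  classical
  rw [Set.ncard_eq_toFinset_card', Set.toFinset_ofPred, Finset.card_filter, Fintype.sum_prod_type]
  refine Finset.sum_congr rfl fun k _ => ?_
  rw [← Finset.card_filter, ← List.toFinset_card_of_nodup (L.nodup k)]
  congr 1
  ext v
  simp [L.mem_iff]

/-- Needed because lg(V/ε) vanishes for `V = 1` and `ε = 1`; an edge that is not a loop excludes `V
= 1`. -/
theorem two_le_of_adj (hG : ∀ v, ¬ G.Adj v v) {i j : Fin V} (h : G.Adj i j) : 2 ≤ V := by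
  have hne : i ≠ j := by
    rintro rfl
    exact hG i h
  have := Fin.val_ne_of_ne hne
  omega

theorem expectedTime_listDFS_le [NeZero V] (L : EdgeList G) {E : ℕ} (a : Fin V) {ε : ℝ}
    (hG : ∀ v, ¬ G.Adj v v) (hE : IsEdgeCount G E) (hE1 : 1 ≤ E) (h0 : 0 < ε) (h1 : ε ≤ 1) :
    2 ≤ V ∧ expectedTime (listDFS L ε a) ≤
      ENNReal.ofReal (7371 * Real.sqrt (V * E * Real.logb 2 (V * ε⁻¹))) := by
  have hsum := sum_length_dest L
  have hD : 1 ≤ ∑ k, (L.dest k).length ∧ ∑ k, (L.dest k).length ≤ 2 * E := by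
    rcases hE with h | ⟨-, h⟩ <;> omega
  have hV : 2 ≤ V := by
    have hne : {p : Fin V × Fin V | G.Adj p.1 p.2}.ncard ≠ 0 := by omega
    obtain ⟨⟨i, j⟩, hij⟩ := Set.nonempty_of_ncard_ne_zero hne
    exact two_le_of_adj hG hij
  exact ⟨hV, expectedTime_dfsLaw_le (represents_listBox L) hV h0 h1 a hD.1
    (by exact_mod_cast hD.2)⟩

theorem expectedTime_matrixDFS_le [NeZero V] (G : Digraph (Fin V)) (a : Fin V) {ε : ℝ} (hV : 2 ≤ V)
    (h0 : 0 < ε) (h1 : ε ≤ 1) : expectedTime (matrixDFS G ε a) ≤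
      ENNReal.ofReal (7371 * Real.sqrt ((V : ℝ) ^ 3 * Real.logb 2 (V * ε⁻¹))) := by
  have hsum : ∑ k, (matrixBox G).size k = V * V := by simp [matrixBox]
  have := expectedTime_dfsLaw_le (represents_matrixBox G) (D := V ^ 2) hV h0 h1 a
    (by rw [hsum]; nlinarith) (by rw [hsum]; push_cast; nlinarith)
  rwa [show (V : ℝ) * V ^ 2 = V ^ 3 by ring] at this

end Models

/-- V/ε ≤ V^(d+1), so the logarithm grows by a factor of at most d + 1. -/
theorem sqrt_logb_le {V d : ℕ} (hV : 2 ≤ V) {ε x : ℝ} (hx : 0 ≤ x) (h0 : 0 < ε)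
    (h : ε⁻¹ ≤ (V : ℝ) ^ d) : 7371 * Real.sqrt (x * Real.logb 2 (V * ε⁻¹)) ≤
      7371 * Real.sqrt (d + 1) * Real.sqrt (x * Real.logb 2 V) := by
  have hV' : (2 : ℝ) ≤ V := by exact_mod_cast hV
  rw [mul_assoc, ← Real.sqrt_mul (by positivity)]
  refine mul_le_mul_of_nonneg_left (Real.sqrt_le_sqrt ?_) (by norm_num)
  rw [mul_left_comm]
  refine mul_le_mul_of_nonneg_left ?_ hx
  calc Real.logb 2 (V * ε⁻¹) ≤ Real.logb 2 ((V : ℝ) ^ (d + 1)) := by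
        refine Real.logb_le_logb_of_le (by norm_num) (by positivity) ?_
        rw [pow_succ']
        gcongr
    _ = _ := by
        rw [Real.logb_pow]
        push_cast
        rfl

end QDFS

end

theorem theorem6 :
    -- edge list model, with the dependence on the probability of failure
    (∃ C : ℝ, ∀ (V : ℕ) [NeZero V] (G : Digraph (Fin V)) (L : QDFS.EdgeList G) (E : ℕ)
      (a : Fin V) (ε : ℝ), (∀ v, ¬ G.Adj v v) → QDFS.IsEdgeCount G E → 1 ≤ E →
      0 < ε → ε ≤ 1 →
      QDFS.failProb G a (QDFS.listDFS L ε a) ≤ ENNReal.ofReal ε ∧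
      QDFS.expectedTime (QDFS.listDFS L ε a) ≤
        ENNReal.ofReal (C * Real.sqrt (V * E * Real.logb 2 (V * ε⁻¹)))) ∧
    -- matrix model, with the dependence on the probability of failure
    (∃ C : ℝ, ∀ (V : ℕ) [NeZero V] (G : Digraph (Fin V)) (a : Fin V) (ε : ℝ),
      (∀ v, ¬ G.Adj v v) → 2 ≤ V → 0 < ε → ε ≤ 1 →
      QDFS.failProb G a (QDFS.matrixDFS G ε a) ≤ ENNReal.ofReal ε ∧
      QDFS.expectedTime (QDFS.matrixDFS G ε a) ≤
        ENNReal.ofReal (C * Real.sqrt ((V : ℝ) ^ 3 * Real.logb 2 (V * ε⁻¹)))) ∧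
    -- edge list model, for a reciprocal probability of failure polynomial in the number of vertices
    (∀ d : ℕ, ∃ C : ℝ, ∀ (V : ℕ) [NeZero V] (G : Digraph (Fin V)) (L : QDFS.EdgeList G) (E : ℕ)
      (a : Fin V) (ε : ℝ), (∀ v, ¬ G.Adj v v) → QDFS.IsEdgeCount G E → 1 ≤ E →
      0 < ε → ε ≤ 1 → ε⁻¹ ≤ (V : ℝ) ^ d →
      QDFS.failProb G a (QDFS.listDFS L ε a) ≤ ENNReal.ofReal ε ∧
      QDFS.expectedTime (QDFS.listDFS L ε a) ≤
        ENNReal.ofReal (C * Real.sqrt (V * E * Real.logb 2 V))) ∧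
    -- matrix model, for a reciprocal probability of failure polynomial in the number of vertices
    (∀ d : ℕ, ∃ C : ℝ, ∀ (V : ℕ) [NeZero V] (G : Digraph (Fin V)) (a : Fin V) (ε : ℝ),
      (∀ v, ¬ G.Adj v v) → 2 ≤ V → 0 < ε → ε ≤ 1 → ε⁻¹ ≤ (V : ℝ) ^ d →
      QDFS.failProb G a (QDFS.matrixDFS G ε a) ≤ ENNReal.ofReal ε ∧
      QDFS.expectedTime (QDFS.matrixDFS G ε a) ≤
        ENNReal.ofReal (C * Real.sqrt ((V : ℝ) ^ 3 * Real.logb 2 V))) := by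
  refine ⟨⟨7371, ?_⟩, ⟨7371, ?_⟩, fun d => ⟨7371 * Real.sqrt (d + 1), ?_⟩,
    fun d => ⟨7371 * Real.sqrt (d + 1), ?_⟩⟩
  · intro V _ G L E a ε hG hE hE1 h0 h1
    exact ⟨QDFS.failProb_dfsLaw_le (QDFS.represents_listBox L) h0 h1 a,
      (QDFS.expectedTime_listDFS_le L a hG hE hE1 h0 h1).2⟩
  · intro V _ G a ε _ hV h0 h1
    exact ⟨QDFS.failProb_dfsLaw_le (QDFS.represents_matrixBox G) h0 h1 a,
      QDFS.expectedTime_matrixDFS_le G a hV h0 h1⟩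
  · intro V _ G L E a ε hG hE hE1 h0 h1 hd
    obtain ⟨hV, h⟩ := QDFS.expectedTime_listDFS_le L a hG hE hE1 h0 h1
    exact ⟨QDFS.failProb_dfsLaw_le (QDFS.represents_listBox L) h0 h1 a,
      h.trans (ENNReal.ofReal_le_ofReal (QDFS.sqrt_logb_le hV (by positivity) h0 hd))⟩
  · intro V _ G a ε _ hV h0 h1 hd
    exact ⟨QDFS.failProb_dfsLaw_le (QDFS.represents_matrixBox G) h0 h1 a,
      (QDFS.expectedTime_matrixDFS_le G a hV h0 h1).trans
        (ENNReal.ofReal_le_ofReal (QDFS.sqrt_logb_le hV (by positivity) h0 hd))⟩
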